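/- Let $\mathbb T=\mathbb R/\mathbb Z$ with Lebesgue measure $\mu$ and write $\{x\}$ for the fractional part of $x$. For irrational $\alpha$ and a measurable integrable function $f:\mathbb T\to(0,\infty)$ put $Tx=x+\alpha$, let $f^{(n)}(x)=\sum_{i=0}^{n-1}f(T^ix)$ for $n\ge 0$ and $f^{(n)}(x)=-\sum_{i=n}^{-1}f(T^{i}x)$ for $n<0$, and let the special flow over $T$ under the roof $f$ be $$T^f_t(x,s)=(T^nx,\;s+t-f^{(n)}(x)),\qquad f^{(n)}(x)\le s+t<f^{(n+1)}(x),$$ on $\mathbb T^f=\{(x,s):x\in\mathbb T,\ 0\le s<f(x)\}$ with the restriction $\mu^f$ of $\mu\otimes\mathrm{Lebesgue}$. Two measure preserving flows $(T_t)$ on $(X,\mu)$ and $(R_t)$ on $(Y,\nu)$ are isomorphic if there is an (almost everywhere) invertible measure preserving map $S:X\to Y$ such that, for every $t\in\mathbb R$, $S\circ T_t=R_t\circ S$ almost everywhere. Theorem 1.1. Let $\alpha,\beta\in\mathbb R$ be irrational, and let $f,g:\mathbb T\to(0,\infty)$ with $\int_{\mathbb T}f\,d\mu=\int_{\mathbb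 T}g\,d\mu=1$ be of the form $$f(x)=A_f\{x\}+f_{ac}(x),\qquad g(x)=A_g\{x\}+g_{ac}(x),$$ where $A_f,A_g\in\mathbb R\setminus\{0\}$ and $f_{ac},g_{ac}\in C^1(\mathbb T)$. If $|A_f|\ne|A_g|$, then the special flow over the rotation by $\alpha$ under $f$ and the special flow over the rotation by $\beta$ under $g$ are not isomorphic. Consequently, the absolute value of the slope is an isomorphism invariant among von Neumann flows with one discontinuity: if $\alpha,\beta$ are irrational, $p,q\in\mathbb R$, and $f(x)=A_f\{x-p\}+f_{ac}(x)$, $g(x)=A_g\{x-q\}+g_{ac}(x)$ are strictly positive with integral $1$, where $A_f,A_g\ne0$ and $f_{ac},g_{ac}\in C^1(\mathbb T)$, and the corresponding special flows over the rotations by $\alpha$ and $\beta$ are isomorphic, then $|A_f|=|A_g|$. -/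

import Mathlib

open MeasureTheory

noncomputable section

namespace VonNeumannFlow

section SpecialFlow

variable {X : Type*}

/-- The cocycle `f^(n)(x)` of a function `f` over an invertible map `T`:
`f(x) + ... + f(T^(n-1) x)` for `n > 0`, `0` for `n = 0`, and
`-(f(T^n x) + ... + f(T^(-1) x))` for `n < 0` (one of the two integer intervals is always empty). -/
def cocycle (T : Equiv.Perm X) (f : X → ℝ) (n : ℤ) (x : X) : ℝ :=
  ∑ i ∈ Finset.Ico 0 n, f ((T ^ i) x) - ∑ i ∈ Finset.Ico n 0, f ((T ^ i) x)

theorem cocycle_succ (T : Equiv.Perm X) (f : X → ℝ) (n : ℤ) (x : X) :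
    cocycle T f (n + 1) x = cocycle T f n x + f ((T ^ n) x) := by
  unfold cocycle
  rcases lt_or_ge n 0 with h | h
  · have h1 : Finset.Ico 0 (n + 1) = (∅ : Finset ℤ) := Finset.Ico_eq_empty (by omega)
    have h2 : Finset.Ico 0 n = (∅ : Finset ℤ) := Finset.Ico_eq_empty (by omega)
    have h3 : Finset.Ico n 0 = insert n (Finset.Ico (n + 1) 0) := by
      ext i; simp only [Finset.mem_insert, Finset.mem_Ico]; omega
    rw [h1, h2, h3, Finset.sum_insert (by simp)]
    ring
  · have h1 : Finset.Ico (n + 1) 0 = (∅ : Finset ℤ) := Finset.Ico_eq_empty (by omega)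
    have h2 : Finset.Ico n 0 = (∅ : Finset ℤ) := Finset.Ico_eq_empty (by omega)
    have h3 : Finset.Ico 0 (n + 1) = insert n (Finset.Ico 0 n) := by
      ext i; simp only [Finset.mem_insert, Finset.mem_Ico]; omega
    rw [h1, h2, h3, Finset.sum_insert (by simp)]
    ring

/-- The phase space `X^f = {(x, s) | 0 ≤ s < f x}`, with the σ-algebra restricted from `X × ℝ`. -/
abbrev Space (f : X → ℝ) : Type _ := {z : X × ℝ // 0 ≤ z.2 ∧ z.2 < f z.1}

/-- The measure `μ^f`, the restriction of `μ ⊗ Lebesgue` to `X^f`. -/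
def spaceMeasure [MeasurableSpace X] (μ : Measure X) (f : X → ℝ) : Measure (Space f) :=
  Measure.comap Subtype.val (μ.prod (volume : Measure ℝ))

open Classical in
/-- The special flow over `T` under `f`: `T^f_t (x, s) = (T^n x, s + t - f^(n)(x))`, where
`f^(n)(x) ≤ s + t < f^(n+1)(x)`. For `f > 0` with `f^(n)(x) → ±∞` as `n → ±∞` such an `n` exists
and is unique; the value in the absence of such an `n` is a convention. -/
def flow (T : Equiv.Perm X) (f : X → ℝ) (t : ℝ) (z : Space f) : Space f :=
  if h : ∃ n : ℤ, cocycle T f n z.1.1 ≤ z.1.2 + t ∧ z.1.2 + t < cocycle T f (n + 1) z.1.1 then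
    ⟨((T ^ h.choose) z.1.1, z.1.2 + t - cocycle T f h.choose z.1.1), by
      have h1 := h.choose_spec.1
      have h2 := h.choose_spec.2
      rw [cocycle_succ] at h2
      exact ⟨by simpa using h1, by simp only; linarith⟩⟩
  else z

end SpecialFlow

/-- Measure-theoretic isomorphism of two flows: an almost everywhere invertible measure
preserving map `S` with `S ∘ T_t = R_t ∘ S` almost everywhere, for every `t`. -/
def FlowIsomorphic {X Y : Type*} [MeasurableSpace X] [MeasurableSpace Y]
    (μ : Measure X) (T : ℝ → X → X) (ν : Measure Y) (R : ℝ → Y → Y) : Prop :=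
  ∃ (S : X → Y) (S' : Y → X),
    MeasurePreserving S μ ν ∧ MeasurePreserving S' ν μ ∧
    (∀ᵐ x ∂μ, S' (S x) = x) ∧ (∀ᵐ y ∂ν, S (S' y) = y) ∧
    ∀ t : ℝ, ∀ᵐ x ∂μ, S (T t x) = R t (S x)

/-- The rotation `x ↦ x + α` of the circle `ℝ / ℤ`. -/
def rotation (α : ℝ) : Equiv.Perm UnitAddCircle := Equiv.addRight (α : UnitAddCircle)

/-- `f` is a normalized strictly positive roof function on the circle with slope `A ≠ 0` and its
only discontinuity at `p`, i.e. `f(x) = A {x - p} + φ(x)` with `φ` of class `C^1` on `ℝ / ℤ`. -/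
structure IsRoof (A p : ℝ) (f : UnitAddCircle → ℝ) : Prop where
  slope_ne_zero : A ≠ 0
  pos : ∀ x, 0 < f x
  integral_eq_one : ∫ x, f x = 1
  decomposition : ∃ φ : UnitAddCircle → ℝ, ContDiff ℝ 1 (fun x : ℝ => φ (x : UnitAddCircle)) ∧
    ∀ x : ℝ, f (x : UnitAddCircle) = A * Int.fract (x - p) + φ (x : UnitAddCircle)

/-- The special flows over the rotations by `α` and `β` under `f` and `g` are isomorphic. -/
def SpecialFlowsIsomorphic (α : ℝ) (f : UnitAddCircle → ℝ) (β : ℝ) (g : UnitAddCircle → ℝ) :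
    Prop :=
  FlowIsomorphic (spaceMeasure volume f) (flow (rotation α) f)
    (spaceMeasure volume g) (flow (rotation β) g)

end VonNeumannFlow

end

/-! The slope is read off the self-correlations `c_E(t) = μ^f(E ∩ T_t⁻¹ E)` at large times: one
special set satisfies an upper bound, every set satisfies a lower bound along certain times, and for
different slopes the two are incompatible.

Upper bound (`exists_box_correlation_le`). Let `E` be a box of small width `ℓ` and height `κ`
standing just to the right of the discontinuity. For `n ≈ t` the ergodic sum `f^(n)` is nearly
affine with slope `A n` between consecutive singularities, and the arc under `E` holds about `ℓ t`
of them. On each piece the points returning to a height window of size `κ` fill a length of at most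
about `κ / (|A| t)` (`volume_returnSet_le`). Hence `c_E(t)` is at most about `V / |A|` with `V = ℓ
κ²`, and `V` is at most the integral of `c_E` over a short interval around `0`.

Lower bound (`exists_times_le_correlation`). If `|q α - P| ≤ 1 / (2 q)` with `P`, `q` coprime, then
`f^(q)` is nearly affine with slope `A q` on half of each of `q` arcs of length `1 / q`
(`rotSum_affine`). At a suitable time `t` near `q` the flow therefore moves the points over these
half-arcs almost vertically, by displacements spread over `(-|A|/4, |A|/4)` with density `1 / |A|`.
So for every measurable `B` the limit inferior of `c_B` along these times is at least `|A|⁻¹ ∫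
c_B(y) dy` over `|y| < |A|/4`.

Comparison (`abs_slope_le`). An isomorphism preserves self-correlations, so applying the lower bound
with slope `A` to the preimage of a box for slope `A'` gives `V / |A| ≤ θ V / |A'|` for every `θ >
1`, that is `|A'| ≤ |A|`; then exchange the flows. All measures are computed in the cover
`UnitAddCircle × ℝ`, where the flow is vertical translation (`spaceMeasure_inter_flow`). -/

noncomputable section

namespace VonNeumannFlow

open Filter Topology Set

/-! ### Uniform convergence of ergodic averages for irrational rotations. -/

/-- The sum of `ψ` over the first `n` points of the orbit of `x` under the rotation by `α`. -/
def rotSum {E : Type*} [AddCommMonoid E] (α : ℝ) (ψ : UnitAddCircle → E) (n : ℕ)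
    (x : UnitAddCircle) : E :=
  ∑ i ∈ Finset.range n, ψ (x + ((i * α : ℝ) : UnitAddCircle))

/-- The ergodic averages of `ψ` over the rotation by `α` converge uniformly to the mean of `ψ`. -/
def UniformlyErgodic {E : Type*} [NormedAddCommGroup E] [NormedSpace ℝ E] (α : ℝ)
    (ψ : UnitAddCircle → E) : Prop :=
  ∀ ε > 0, ∃ N : ℕ, ∀ n ≥ N, ∀ x, ‖rotSum α ψ n x - (n : ℝ) • ∫ y, ψ y‖ ≤ ε * n

theorem integrable_of_continuous_circle {E : Type*} [NormedAddCommGroup E] [NormedSpace ℝ E]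
    {ψ : UnitAddCircle → E} (h : Continuous ψ) : Integrable ψ :=
  h.integrable_of_hasCompactSupport (HasCompactSupport.of_compactSpace ψ)

/-- For `k ≠ 0` the ergodic sum is a geometric sum of ratio `z = e^(2πikα) ≠ 1`, hence bounded by `2
/ ‖z - 1‖`. The mean vanishes because translation by `α` multiplies it by `z`. -/
theorem uniformlyErgodic_fourier {α : ℝ} (hα : Irrational α) (k : ℤ) :
    UniformlyErgodic α (fun x : UnitAddCircle => fourier k x) := by
  by_cases hk : k = 0
  · subst hk
    intro ε hε
    refine ⟨0, fun n _ x => ?_⟩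
    have : 0 ≤ ε * n := by positivity
    simpa [rotSum, Measure.real] using this
  have hmul : ∀ x y : UnitAddCircle, fourier k (x + y) = fourier k x * fourier k y := by
    intro x y
    simp [fourier_apply, smul_add, AddCircle.toCircle_add]
  set z : ℂ := fourier k ((α : ℝ) : UnitAddCircle) with hz
  have hz1 : z ≠ 1 := by
    intro h
    rw [hz, fourier_coe_apply, Complex.exp_eq_one_iff] at h
    obtain ⟨m, hm⟩ := h
    have hpi : (2 * Real.pi * Complex.I : ℂ) ≠ 0 := by
      simp [Real.pi_ne_zero]
    have h2 : (k : ℂ) * α = m := by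
      apply mul_left_cancel₀ hpi
      simp only [Complex.ofReal_one, div_one] at hm
      linear_combination hm
    have h3 : (k : ℝ) * α = m := by exact_mod_cast h2
    exact (hα.intCast_mul hk).ne_int m h3
  have hint : ∫ y : UnitAddCircle, fourier k y = 0 := by
    have h1 : ∫ y : UnitAddCircle, fourier k (y + ((α : ℝ) : UnitAddCircle))
        = ∫ y : UnitAddCircle, fourier k y :=
      integral_add_right_eq_self (fun y : UnitAddCircle => fourier k y) _
    simp_rw [hmul, integral_mul_const] at h1
    have h2 : (∫ y : UnitAddCircle, fourier k y) * (z - 1) = 0 := by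
      rw [mul_sub, h1, mul_one, sub_self]
    exact (mul_eq_zero.1 h2).resolve_right (sub_ne_zero.2 hz1)
  have hpow : ∀ i : ℕ, fourier k ((i * α : ℝ) : UnitAddCircle) = z ^ i := by
    intro i
    induction i with
    | zero => simp
    | succ i ih =>
      rw [pow_succ, ← ih, hz, ← hmul, ← AddCircle.coe_add]
      push_cast
      ring_nf
  have hn1 : ∀ x : UnitAddCircle, ‖fourier k x‖ = 1 := fun x => Circle.norm_coe _
  intro ε hε
  obtain ⟨N, hN⟩ := exists_nat_ge (2 / ‖z - 1‖ / ε)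
  refine ⟨N, fun n hn x => ?_⟩
  rw [hint, smul_zero, sub_zero, rotSum]
  simp_rw [hmul, hpow]
  rw [← Finset.mul_sum, norm_mul, hn1, one_mul, geom_sum_eq hz1, norm_div]
  have h1 : ‖z ^ n - 1‖ ≤ 2 := by
    refine (norm_sub_le _ _).trans ?_
    rw [norm_pow, hn1]
    norm_num
  have h2 : 0 < ‖z - 1‖ := norm_pos_iff.2 (sub_ne_zero.2 hz1)
  calc ‖z ^ n - 1‖ / ‖z - 1‖ ≤ 2 / ‖z - 1‖ := by gcongr
    _ ≤ N * ε := by rwa [div_le_iff₀ hε] at hN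
    _ ≤ ε * n := by rw [mul_comm]; gcongr

theorem rotSum_add {E : Type*} [AddCommMonoid E] (α : ℝ) (ψ χ : UnitAddCircle → E) (n : ℕ)
    (x : UnitAddCircle) :
    rotSum α (fun y => ψ y + χ y) n x = rotSum α ψ n x + rotSum α χ n x := by
  simp [rotSum, Finset.sum_add_distrib]

/-- The property is linear and passes to uniform limits, and trigonometric polynomials are uniformly
dense. -/
theorem uniformlyErgodic_complex {α : ℝ} (hα : Irrational α) (ψ : C(UnitAddCircle, ℂ)) :
    UniformlyErgodic α ψ := by
  have hspan : ∀ φ ∈ Submodule.span ℂ (range (@fourier 1)),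
      UniformlyErgodic α (φ : UnitAddCircle → ℂ) := by
    intro φ hφ
    induction hφ using Submodule.span_induction with
    | mem φ h =>
      obtain ⟨k, rfl⟩ := h
      exact uniformlyErgodic_fourier hα k
    | zero =>
      intro ε hε
      refine ⟨0, fun n _ x => ?_⟩
      simp [rotSum]
      positivity
    | add φ χ _ _ h1 h2 =>
      intro ε hε
      obtain ⟨N1, h1⟩ := h1 (ε / 2) (by positivity)
      obtain ⟨N2, h2⟩ := h2 (ε / 2) (by positivity)
      refine ⟨max N1 N2, fun n hn x => ?_⟩
      have e : rotSum α (φ + χ : C(UnitAddCircle, ℂ)) n x - (n : ℝ) • ∫ y, (φ + χ) y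
          = (rotSum α φ n x - (n : ℝ) • ∫ y, φ y) + (rotSum α χ n x - (n : ℝ) • ∫ y, χ y) := by
        have : rotSum α (φ + χ : C(UnitAddCircle, ℂ)) n x = rotSum α φ n x + rotSum α χ n x :=
          rotSum_add α φ χ n x
        rw [this]
        simp only [ContinuousMap.add_apply]
        rw [integral_add (integrable_of_continuous_circle φ.continuous)
          (integrable_of_continuous_circle χ.continuous), smul_add]
        abel
      rw [e]
      refine (norm_add_le _ _).trans ?_
      have := h1 n (le_of_max_le_left hn) x
      have := h2 n (le_of_max_le_right hn) x
      linarith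
    | smul c φ _ h =>
      intro ε hε
      obtain ⟨N, h⟩ := h (ε / (‖c‖ + 1)) (by positivity)
      refine ⟨N, fun n hn x => ?_⟩
      have e : rotSum α (c • φ : C(UnitAddCircle, ℂ)) n x - (n : ℝ) • ∫ y, (c • φ) y
          = c * (rotSum α φ n x - (n : ℝ) • ∫ y, φ y) := by
        simp only [rotSum, ContinuousMap.smul_apply, smul_eq_mul, ← Finset.mul_sum,
          integral_const_mul]
        rw [mul_sub, mul_smul_comm]
      rw [e, norm_mul]
      calc ‖c‖ * _ ≤ (‖c‖ + 1) * (ε / (‖c‖ + 1) * n) := by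
            gcongr
            · linarith
            · exact h n hn x
        _ = ε * n := by field_simp
  intro ε hε
  have hmem : ψ ∈ (Submodule.span ℂ (range (@fourier 1))).topologicalClosure := by
    rw [span_fourier_closure_eq_top]; trivial
  obtain ⟨(φ : C(UnitAddCircle, ℂ)), hφ, hd⟩ := Metric.mem_closure_iff.1 hmem (ε / 3) (by positivity)
  obtain ⟨N, hN⟩ := hspan φ hφ (ε / 3) (by positivity)
  refine ⟨N, fun n hn x => ?_⟩
  have hpt : ∀ y, ‖ψ y - φ y‖ ≤ ε / 3 := fun y => by
    rw [← dist_eq_norm]; exact (ContinuousMap.dist_apply_le_dist y).trans hd.le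
  have h1 : ‖rotSum α ψ n x - rotSum α φ n x‖ ≤ ε / 3 * n := by
    rw [rotSum, rotSum, ← Finset.sum_sub_distrib]
    refine (norm_sum_le_of_le _ fun i _ => hpt _).trans ?_
    simp [mul_comm]
  have h2 : ‖(n : ℝ) • (∫ y, φ y) - (n : ℝ) • ∫ y, ψ y‖ ≤ ε / 3 * n := by
    rw [← smul_sub, ← integral_sub (integrable_of_continuous_circle φ.continuous)
      (integrable_of_continuous_circle ψ.continuous), norm_smul, Real.norm_natCast, mul_comm]
    gcongr
    refine (norm_integral_le_of_norm_le_const (C := ε / 3) (ae_of_all _ fun y => ?_)).trans ?_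
    · rw [norm_sub_rev]; exact hpt y
    · simp [Measure.real]
  have e : rotSum α ψ n x - (n : ℝ) • ∫ y, ψ y = (rotSum α ψ n x - rotSum α φ n x)
      + (rotSum α φ n x - (n : ℝ) • ∫ y, φ y)
      + ((n : ℝ) • (∫ y, φ y) - (n : ℝ) • ∫ y, ψ y) := by abel
  rw [e]
  refine (norm_add₃_le).trans ?_
  have := hN n hn x
  linarith

/-- Unique ergodicity of irrational rotations of the circle. -/
theorem uniformlyErgodic_of_continuous {α : ℝ} (hα : Irrational α) {ψ : UnitAddCircle → ℝ}
    (hψ : Continuous ψ) : UniformlyErgodic α ψ := by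
  intro ε hε
  obtain ⟨N, hN⟩ := uniformlyErgodic_complex hα
    ⟨fun x => (ψ x : ℂ), Complex.continuous_ofReal.comp hψ⟩ ε hε
  refine ⟨N, fun n hn x => ?_⟩
  have := hN n hn x
  simp only [rotSum, ContinuousMap.coe_mk] at this
  rw [integral_complex_ofReal, ← Complex.ofReal_sum, Complex.real_smul, ← Complex.ofReal_mul,
    ← Complex.ofReal_sub, Complex.norm_real] at this
  simpa [rotSum] using this

theorem UniformlyErgodic.add {α : ℝ} {ψ χ : UnitAddCircle → ℝ} (h1 : UniformlyErgodic α ψ)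
    (h2 : UniformlyErgodic α χ) (i1 : Integrable ψ) (i2 : Integrable χ) :
    UniformlyErgodic α (fun x => ψ x + χ x) := by
  intro ε hε
  obtain ⟨N1, h1⟩ := h1 (ε / 2) (by positivity)
  obtain ⟨N2, h2⟩ := h2 (ε / 2) (by positivity)
  refine ⟨max N1 N2, fun n hn x => ?_⟩
  have e : rotSum α (fun x => ψ x + χ x) n x - (n : ℝ) • ∫ y, (ψ y + χ y)
      = (rotSum α ψ n x - (n : ℝ) • ∫ y, ψ y) + (rotSum α χ n x - (n : ℝ) • ∫ y, χ y) := by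
    rw [rotSum_add, integral_add i1 i2, smul_add]
    abel
  rw [e]
  refine (norm_add_le _ _).trans ?_
  have := h1 n (le_of_max_le_left hn) x
  have := h2 n (le_of_max_le_right hn) x
  linarith

theorem UniformlyErgodic.const_mul {α : ℝ} {ψ : UnitAddCircle → ℝ} (h : UniformlyErgodic α ψ)
    (c : ℝ) : UniformlyErgodic α (fun x => c * ψ x) := by
  intro ε hε
  obtain ⟨N, h⟩ := h (ε / (‖c‖ + 1)) (by positivity)
  refine ⟨N, fun n hn x => ?_⟩
  have e : rotSum α (fun x => c * ψ x) n x - (n : ℝ) • ∫ y, c * ψ y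
      = c * (rotSum α ψ n x - (n : ℝ) • ∫ y, ψ y) := by
    simp only [rotSum, smul_eq_mul, ← Finset.mul_sum, integral_const_mul]
    ring
  rw [e, norm_mul]
  calc ‖c‖ * _ ≤ (‖c‖ + 1) * (ε / (‖c‖ + 1) * n) := by
        gcongr
        · linarith
        · exact h n hn x
    _ = ε * n := by field_simp

theorem UniformlyErgodic.comp_sub {α : ℝ} {ψ : UnitAddCircle → ℝ} (h : UniformlyErgodic α ψ)
    (p : UnitAddCircle) : UniformlyErgodic α (fun x => ψ (x - p)) := by
  intro ε hε
  obtain ⟨N, h⟩ := h ε hε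
  refine ⟨N, fun n hn x => ?_⟩
  have := h n hn (x - p)
  rw [integral_sub_right_eq_self ψ p]
  simp only [rotSum] at this ⊢
  simpa only [add_sub_right_comm] using this

/-- A function squeezed between continuous functions with nearly equal means has uniformly
convergent ergodic averages. -/
theorem UniformlyErgodic.of_squeeze {α : ℝ} (hα : Irrational α) {ψ : UnitAddCircle → ℝ}
    (h : ∀ ε > 0, ∃ ψ₁ ψ₂ : UnitAddCircle → ℝ, Continuous ψ₁ ∧ Continuous ψ₂ ∧
      (∀ x, ψ₁ x ≤ ψ x) ∧ (∀ x, ψ x ≤ ψ₂ x) ∧ ∫ x, ψ x ≤ (∫ x, ψ₁ x) + ε ∧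
      ∫ x, ψ₂ x ≤ (∫ x, ψ x) + ε) : UniformlyErgodic α ψ := by
  intro ε hε
  obtain ⟨ψ₁, ψ₂, c1, c2, l1, l2, i1, i2⟩ := h (ε / 2) (by positivity)
  obtain ⟨N1, h1⟩ := uniformlyErgodic_of_continuous hα c1 (ε / 2) (by positivity)
  obtain ⟨N2, h2⟩ := uniformlyErgodic_of_continuous hα c2 (ε / 2) (by positivity)
  refine ⟨max N1 N2, fun n hn x => ?_⟩
  have h1 := h1 n (le_of_max_le_left hn) x
  have h2 := h2 n (le_of_max_le_right hn) x
  have s1 : rotSum α ψ₁ n x ≤ rotSum α ψ n x := Finset.sum_le_sum fun _ _ => l1 _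
  have s2 : rotSum α ψ n x ≤ rotSum α ψ₂ n x := Finset.sum_le_sum fun _ _ => l2 _
  rw [Real.norm_eq_abs, abs_le, smul_eq_mul] at *
  have hn0 : (0 : ℝ) ≤ n := n.cast_nonneg
  have m1 := mul_le_mul_of_nonneg_left i1 hn0
  have m2 := mul_le_mul_of_nonneg_left i2 hn0
  constructor <;> nlinarith

/-- The representative in `[0, 1)` of a point of the circle. -/
def circleFract (x : UnitAddCircle) : ℝ := (AddCircle.equivIco 1 0 x).1

theorem circleFract_coe (x : ℝ) : circleFract (x : UnitAddCircle) = Int.fract x := by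
  simp [circleFract, AddCircle.coe_equivIco_mk_apply]

theorem circleFract_nonneg (x : UnitAddCircle) : 0 ≤ circleFract x :=
  (AddCircle.equivIco 1 0 x).2.1

theorem circleFract_lt_one (x : UnitAddCircle) : circleFract x < 1 :=
  (AddCircle.equivIco 1 0 x).2.2.trans_eq (zero_add 1)

theorem coe_circleFract (x : UnitAddCircle) : ((circleFract x : ℝ) : UnitAddCircle) = x :=
  AddCircle.coe_equivIco

theorem measurable_circleFract : Measurable circleFract :=
  measurable_subtype_coe.comp (AddCircle.measurableEquivIco 1 0).measurable

theorem integrable_circleFract : Integrable circleFract :=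
  Integrable.of_bound measurable_circleFract.aestronglyMeasurable 1
    (ae_of_all _ fun x => by
      rw [Real.norm_eq_abs, abs_of_nonneg (circleFract_nonneg x)]
      exact (circleFract_lt_one x).le)

theorem integral_circleFract : ∫ x, circleFract x = 1 / 2 := by
  rw [← UnitAddCircle.intervalIntegral_preimage 0, zero_add]
  have : ∫ a in (0 : ℝ)..1, circleFract (a : UnitAddCircle) = ∫ a in (0 : ℝ)..1, a := by
    apply intervalIntegral.integral_congr_ae
    have h1 : ∀ᵐ a : ℝ, a ≠ 1 := by
      simp [ae_iff]
    filter_upwards [h1] with a ha1 ha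
    rw [uIoc_of_le zero_le_one] at ha
    rw [circleFract_coe, Int.fract_eq_self.2 ⟨ha.1.le, lt_of_le_of_ne ha.2 ha1⟩]
  rw [this, integral_id]
  norm_num

/-- The left side is an integer below `2`. Through this inequality, reflecting a continuous minorant
of the sawtooth produces a continuous majorant. -/
theorem circleFract_add_neg_le (x : UnitAddCircle) : circleFract x + circleFract (-x) ≤ 1 := by
  have h : ((circleFract x + circleFract (-x) : ℝ) : UnitAddCircle) = 0 := by
    rw [AddCircle.coe_add, coe_circleFract, coe_circleFract, add_neg_cancel]
  obtain ⟨n, hn⟩ := (AddCircle.coe_eq_zero_iff 1).1 h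
  have h1 := circleFract_lt_one x
  have h2 := circleFract_lt_one (-x)
  rw [zsmul_eq_mul, mul_one] at hn
  have : (n : ℝ) < 2 := by linarith
  have : n < 2 := by exact_mod_cast this
  have : n ≤ 1 := by omega
  rw [← hn]
  exact_mod_cast this

theorem continuous_circleFract_mul_min (K : ℝ) :
    Continuous fun x : UnitAddCircle => circleFract x * min 1 (K * ‖x‖) := by
  rw [continuous_iff_continuousAt]
  intro x
  by_cases hx : x = 0
  · subst hx
    have h0 : Tendsto (fun x : UnitAddCircle => |min 1 (K * ‖x‖)|) (𝓝 0) (𝓝 0) := by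
      have : Continuous fun x : UnitAddCircle => |min 1 (K * ‖x‖)| := by fun_prop
      simpa using this.tendsto 0
    unfold ContinuousAt
    simp only [norm_zero, mul_zero, zero_le_one, min_eq_right]
    refine squeeze_zero_norm (fun y => ?_) h0
    rw [norm_mul, Real.norm_eq_abs, Real.norm_eq_abs, abs_of_nonneg (circleFract_nonneg y)]
    exact mul_le_of_le_one_left (abs_nonneg _) (circleFract_lt_one y).le
  · refine ContinuousAt.mul ?_ (by fun_prop)
    exact continuous_subtype_val.continuousAt.comp
      (AddCircle.continuousAt_equivIco 1 0 (by simpa using hx))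

theorem uniformlyErgodic_circleFract {α : ℝ} (hα : Irrational α) :
    UniformlyErgodic α circleFract := by
  refine UniformlyErgodic.of_squeeze hα fun ε hε => ?_
  -- The minorant differs from the sawtooth only on the ball of radius `1 / K`, whose measure is at
  -- most `2 / K = ε`.
  set K := 2 / ε with hK
  have hKpos : 0 < K := by positivity
  have hc := continuous_circleFract_mul_min K
  have hle : ∀ x : UnitAddCircle, circleFract x * min 1 (K * ‖x‖) ≤ circleFract x := fun x =>
    mul_le_of_le_one_right (circleFract_nonneg x) (min_le_left _ _)
  have hi := integrable_of_continuous_circle hc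
  have hint : ∫ x, circleFract x ≤ (∫ x : UnitAddCircle, circleFract x * min 1 (K * ‖x‖)) + ε := by
    rw [← sub_le_iff_le_add', ← integral_sub integrable_circleFract hi]
    calc ∫ x : UnitAddCircle, (circleFract x - circleFract x * min 1 (K * ‖x‖))
        ≤ ∫ x : UnitAddCircle, (Metric.closedBall (0 : UnitAddCircle) (1 / K)).indicator 1 x := by
          refine integral_mono (integrable_circleFract.sub hi)
            ((integrable_const (1 : ℝ)).indicator measurableSet_closedBall) fun x => ?_
          have h0 := circleFract_nonneg x
          have h1 := circleFract_lt_one x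
          by_cases hx : x ∈ Metric.closedBall (0 : UnitAddCircle) (1 / K)
          · simp only [indicator_of_mem hx, Pi.one_apply]
            have : 0 ≤ circleFract x * min 1 (K * ‖x‖) := by positivity
            linarith
          · simp only [indicator_of_notMem hx]
            rw [mem_closedBall_zero_iff, not_le, div_lt_iff₀ hKpos] at hx
            rw [min_eq_left (by linarith)]
            simp
      _ = (volume (Metric.closedBall (0 : UnitAddCircle) (1 / K))).toReal := by
          rw [integral_indicator_one measurableSet_closedBall]; rfl
      _ ≤ ε := by
          rw [AddCircle.volume_closedBall, ENNReal.toReal_ofReal (by positivity)]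
          refine (min_le_right _ _).trans ?_
          rw [hK]; field_simp; rfl
  refine ⟨_, fun x => 1 - circleFract (-x) * min 1 (K * ‖-x‖), hc,
    continuous_const.sub (hc.comp continuous_neg), hle, fun x => ?_, hint, ?_⟩
  · have := circleFract_add_neg_le x
    have := hle (-x)
    linarith
  · have hi' : Integrable fun x : UnitAddCircle => circleFract (-x) * min 1 (K * ‖-x‖) :=
      integrable_of_continuous_circle (hc.comp continuous_neg)
    have e1 : ∫ x : UnitAddCircle, circleFract (-x) * min 1 (K * ‖-x‖)
        = ∫ x : UnitAddCircle, circleFract x * min 1 (K * ‖x‖) :=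
      integral_neg_eq_self (fun x : UnitAddCircle => circleFract x * min 1 (K * ‖x‖)) volume
    rw [integral_sub (integrable_const _) hi', e1]
    rw [integral_circleFract] at *
    have : ∫ _ : UnitAddCircle, (1 : ℝ) = 1 := by simp [Measure.real]
    linarith

/-- The number of the first `n` orbit points in the arc `[0, ℓ)`. -/
theorem card_filter_circleFract_lt {α : ℝ} (hα : Irrational α) {ℓ : ℝ} (h0 : 0 ≤ ℓ) (h1 : ℓ < 1)
    {η : ℝ} (hη : 0 < η) : ∃ N : ℕ, ∀ n ≥ N, ∀ x : UnitAddCircle,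
      (((Finset.range n).filter fun i : ℕ =>
        circleFract (x + ((i * α : ℝ) : UnitAddCircle)) < ℓ).card : ℝ) ≤ (ℓ + η) * n := by
  obtain ⟨N, hN⟩ := uniformlyErgodic_circleFract hα (η / 2) (by positivity)
  refine ⟨N, fun n hn x => ?_⟩
  -- The indicator of an arc is a constant plus a difference of two translated sawtooths, so visits
  -- are counted by two ergodic sums of `circleFract`, each with error `η / 2`.
  have key : ∀ y : UnitAddCircle, (if circleFract y < ℓ then (1 : ℝ) else 0)
      = ℓ - circleFract y + circleFract (y - (ℓ : UnitAddCircle)) := by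
    intro y
    have e : y - (ℓ : UnitAddCircle) = ((circleFract y - ℓ : ℝ) : UnitAddCircle) := by
      rw [AddCircle.coe_sub, coe_circleFract]
    have g0 := circleFract_nonneg y
    have g1 := circleFract_lt_one y
    rw [e, circleFract_coe]
    split_ifs with h
    · have : Int.fract (circleFract y - ℓ) = circleFract y - ℓ + 1 := by
        rw [Int.fract_eq_iff]
        exact ⟨by linarith, by linarith, -1, by push_cast; ring⟩
      rw [this]; ring
    · rw [Int.fract_eq_self.2 ⟨by linarith, by linarith⟩]; ring
  have h2 := hN n hn x
  have h3 := hN n hn (x - (ℓ : UnitAddCircle))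
  rw [Finset.card_filter]
  push_cast
  simp_rw [key]
  rw [Finset.sum_add_distrib, Finset.sum_sub_distrib]
  simp only [rotSum, Real.norm_eq_abs, abs_le] at h2 h3
  simp_rw [add_sub_right_comm]
  simp only [Finset.sum_const, Finset.card_range, nsmul_eq_mul]
  nlinarith [h2.1, h3.2]

/-! ### Ergodic sums of `C^1` functions. -/

theorem continuous_of_coe {E : Type*} [TopologicalSpace E] {φ : UnitAddCircle → E}
    (h : Continuous fun x : ℝ => φ (x : UnitAddCircle)) : Continuous φ :=
  (QuotientAddGroup.isQuotientMap_mk (N := AddSubgroup.zmultiples (1 : ℝ))).continuous_iff.2 h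

/-- Ergodic sums of a `C^1` function have Lipschitz constants of sublinear growth. -/
theorem rotSum_lipschitz {α : ℝ} (hα : Irrational α) {φ : UnitAddCircle → ℝ}
    (hφ : ContDiff ℝ 1 fun x : ℝ => φ (x : UnitAddCircle)) {η : ℝ} (hη : 0 < η) :
    ∃ C : ℝ, 0 ≤ C ∧ ∀ (n : ℕ) (x y : ℝ),
      |rotSum α φ n (x : UnitAddCircle) - rotSum α φ n (y : UnitAddCircle)|
        ≤ (η * n + C) * |x - y| := by
  set F : ℝ → ℝ := fun x => φ (x : UnitAddCircle) with hF
  have hper : Function.Periodic (deriv F) 1 := by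
    intro x
    rw [← deriv_comp_add_const]
    congr 1
    ext y
    simp [hF]
  have hFd : Differentiable ℝ F := hφ.differentiable (by norm_num)
  have hdc : Continuous (deriv F) := hφ.continuous_deriv (le_refl _)
  set ψ : UnitAddCircle → ℝ := hper.lift with hψ
  have hψc : ∀ x : ℝ, ψ (x : UnitAddCircle) = deriv F x := fun x => hper.lift_coe x
  have hψcont : Continuous ψ := continuous_of_coe (by simpa only [hψc] using hdc)
  -- The derivative of a periodic function has mean zero, so its ergodic sums are `o(n)` uniformly;
  -- this is the source of the sublinear Lipschitz constant.
  have hint : ∫ x, ψ x = 0 := by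
    rw [← UnitAddCircle.intervalIntegral_preimage 0]
    simp_rw [hψc]
    rw [intervalIntegral.integral_deriv_eq_sub (fun x _ => hFd x) (hdc.intervalIntegrable _ _)]
    simp [hF, AddCircle.coe_period (1 : ℝ)]
  obtain ⟨N, hN⟩ := uniformlyErgodic_of_continuous hα hψcont η hη
  obtain ⟨B, hB⟩ := isCompact_univ.exists_bound_of_continuousOn hψcont.continuousOn
  have hB0 : 0 ≤ B := (norm_nonneg _).trans (hB 0 (mem_univ _))
  have hbound : ∀ n x, ‖rotSum α ψ n x‖ ≤ η * n + N * B := by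
    intro n x
    rcases le_or_gt N n with h | h
    · have := hN n h x
      rw [hint, smul_zero, sub_zero] at this
      have : 0 ≤ N * B := by positivity
      linarith
    · have h1 : ‖rotSum α ψ n x‖ ≤ n * B := by
        refine (norm_sum_le_of_le _ fun i _ => hB _ (mem_univ _)).trans ?_
        simp
      have h2 : (n : ℝ) * B ≤ N * B := by gcongr
      have : 0 ≤ η * n := by positivity
      linarith
  refine ⟨N * B, by positivity, fun n x y => ?_⟩
  have hd : ∀ z : ℝ, HasDerivAt (fun z : ℝ => rotSum α φ n (z : UnitAddCircle))
      (rotSum α ψ n (z : UnitAddCircle)) z := by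
    intro z
    simp only [rotSum, ← AddCircle.coe_add, hψc]
    apply HasDerivAt.fun_sum
    intro i _
    exact (hFd (z + i * α)).hasDerivAt.comp_add_const z (i * α)
  have := Convex.norm_image_sub_le_of_norm_hasDerivWithin_le (s := univ)
    (fun z _ => (hd z).hasDerivWithinAt) (fun z _ => hbound n z) convex_univ
    (mem_univ y) (mem_univ x)
  simpa [Real.norm_eq_abs] using this

/-! ### Cocycles and the covering of the special flow by vertical translation. -/

section Cocycle

variable {X : Type*}

theorem cocycle_zero (T : Equiv.Perm X) (f : X → ℝ) (x : X) : cocycle T f 0 x = 0 := by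
  simp [cocycle]

theorem cocycle_add (T : Equiv.Perm X) (f : X → ℝ) (m n : ℤ) (x : X) :
    cocycle T f (m + n) x = cocycle T f n x + cocycle T f m ((T ^ n) x) := by
  induction m using Int.induction_on with
  | zero => simp [cocycle_zero]
  | succ k ih =>
    rw [show (k : ℤ) + 1 + n = (k + n) + 1 by ring, cocycle_succ, cocycle_succ, ih, zpow_add,
      Equiv.Perm.mul_apply]
    ring
  | pred k ih =>
    have h1 := cocycle_succ T f (-k - 1 + n) x
    have h2 := cocycle_succ T f (-k - 1) ((T ^ n) x)
    rw [show -(k : ℤ) - 1 + n + 1 = -k + n by ring, ih, zpow_add, Equiv.Perm.mul_apply] at h1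
    rw [show -(k : ℤ) - 1 + 1 = -k by ring] at h2
    linarith

theorem cocycle_strictMono (T : Equiv.Perm X) {f : X → ℝ} (hf : ∀ x, 0 < f x) (x : X) :
    StrictMono fun n => cocycle T f n x :=
  strictMono_int_of_lt_succ fun n => by
    rw [cocycle_succ]
    linarith [hf ((T ^ n) x)]

/-- The deck transformations of the covering of the special flow by the translation flow. -/
def deck (T : Equiv.Perm X) (f : X → ℝ) (n : ℤ) (z : X × ℝ) : X × ℝ :=
  ((T ^ n) z.1, z.2 - cocycle T f n z.1)

theorem deck_deck (T : Equiv.Perm X) (f : X → ℝ) (m n : ℤ) (z : X × ℝ) :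
    deck T f m (deck T f n z) = deck T f (m + n) z := by
  simp only [deck, cocycle_add, zpow_add, Equiv.Perm.mul_apply]
  ext <;> simp
  ring

/-- The preimage of `B` under the covering map onto the phase space of the special flow. -/
def lift (T : Equiv.Perm X) (f : X → ℝ) (B : Set (Space f)) : Set (X × ℝ) :=
  ⋃ n : ℤ, deck T f n ⁻¹' (Subtype.val '' B)

theorem deck_mem_lift_iff (T : Equiv.Perm X) (f : X → ℝ) (B : Set (Space f)) (n : ℤ) (z : X × ℝ) :
    deck T f n z ∈ lift T f B ↔ z ∈ lift T f B := by
  simp only [lift, mem_iUnion, mem_preimage, deck_deck]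
  constructor
  · rintro ⟨m, hm⟩
    exact ⟨m + n, hm⟩
  · rintro ⟨m, hm⟩
    exact ⟨m - n, by simpa using hm⟩

theorem mem_lift_of_mem (T : Equiv.Perm X) (f : X → ℝ) {B : Set (Space f)} {z : X × ℝ}
    (hz : z ∈ Subtype.val '' B) : z ∈ lift T f B :=
  mem_iUnion.2 ⟨0, by simpa [deck, cocycle_zero] using hz⟩

/-- Upstairs the flow is vertical translation followed by the deck transformation that returns to
the phase space. Strict monotonicity of the cocycle makes its index unique, which removes the choice
made in `flow`. -/
theorem mem_flow_iff (T : Equiv.Perm X) {f : X → ℝ} (hf : ∀ x, 0 < f x) {t : ℝ} {z : Space f}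
    (hn : ∃ n : ℤ, cocycle T f n z.1.1 ≤ z.1.2 + t ∧ z.1.2 + t < cocycle T f (n + 1) z.1.1)
    (B : Set (Space f)) : flow T f t z ∈ B ↔ (z.1.1, z.1.2 + t) ∈ lift T f B := by
  have hflow : (flow T f t z).1 = deck T f hn.choose (z.1.1, z.1.2 + t) := by
    rw [flow, dif_pos hn]
    rfl
  simp only [lift, mem_iUnion, mem_preimage]
  constructor
  · intro h
    exact ⟨hn.choose, _, h, hflow⟩
  · rintro ⟨m, w, hw, hwm⟩
    have e : m = hn.choose := by
      have h1 := w.2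
      rw [hwm] at h1
      simp only [deck] at h1
      have h2 : z.1.2 + t < cocycle T f (m + 1) z.1.1 := by rw [cocycle_succ]; linarith [h1.2]
      have h3 : cocycle T f m z.1.1 ≤ z.1.2 + t := by linarith [h1.1]
      have h4 := hn.choose_spec
      have a1 := (cocycle_strictMono T hf z.1.1).lt_iff_lt.1 (h3.trans_lt h4.2)
      have a2 := (cocycle_strictMono T hf z.1.1).lt_iff_lt.1 (h4.1.trans_lt h2)
      omega
    have : w = flow T f t z := by
      apply Subtype.ext
      rw [hwm, e, hflow]
    rwa [← this]

end Cocycle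

theorem rotation_zpow (α : ℝ) (n : ℤ) (x : UnitAddCircle) :
    (rotation α ^ n) x = x + ((n * α : ℝ) : UnitAddCircle) := by
  induction n using Int.induction_on with
  | zero => simp
  | succ k ih =>
    rw [add_comm, zpow_add, Equiv.Perm.mul_apply, ih, zpow_one, rotation, Equiv.coe_addRight]
    beta_reduce
    rw [add_assoc, ← AddCircle.coe_add]
    push_cast
    ring_nf
  | pred k ih =>
    rw [sub_eq_add_neg, add_comm, zpow_add, Equiv.Perm.mul_apply, ih, zpow_neg, zpow_one, rotation,
      Equiv.Perm.inv_def, Equiv.addRight_symm, Equiv.coe_addRight]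
    beta_reduce
    rw [add_assoc, ← AddCircle.coe_neg, ← AddCircle.coe_add]
    push_cast
    ring_nf

theorem cocycle_natCast (α : ℝ) (f : UnitAddCircle → ℝ) (n : ℕ) (x : UnitAddCircle) :
    cocycle (rotation α) f n x = rotSum α f n x := by
  induction n with
  | zero => simp [cocycle_zero, rotSum]
  | succ n ih =>
    push_cast
    rw [cocycle_succ, ih, rotSum, rotSum, Finset.sum_range_succ, rotation_zpow]
    simp

/-! ### Special flows under von Neumann roofs: measurability and correlations. -/

namespace IsRoof

variable {A p : ℝ} {f : UnitAddCircle → ℝ}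

theorem exists_eq (h : IsRoof A p f) : ∃ φ : UnitAddCircle → ℝ,
    ContDiff ℝ 1 (fun x : ℝ => φ (x : UnitAddCircle)) ∧
    ∀ x : UnitAddCircle, f x = A * circleFract (x - (p : UnitAddCircle)) + φ x := by
  obtain ⟨φ, hφ, h⟩ := h.decomposition
  refine ⟨φ, hφ, fun x => ?_⟩
  have := h (circleFract x)
  rw [coe_circleFract] at this
  rw [this, ← circleFract_coe, AddCircle.coe_sub, coe_circleFract]

theorem measurable (h : IsRoof A p f) : Measurable f := by
  obtain ⟨φ, hφ, hf⟩ := h.exists_eq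
  rw [funext hf]
  exact ((measurable_circleFract.comp (measurable_id.sub_const _)).const_mul A).add
    (continuous_of_coe hφ.continuous).measurable

theorem exists_bound (h : IsRoof A p f) : ∃ M, ∀ x, f x ≤ M := by
  obtain ⟨φ, hφ, hf⟩ := h.exists_eq
  obtain ⟨B, hB⟩ := isCompact_univ.exists_bound_of_continuousOn
    (continuous_of_coe hφ.continuous).continuousOn
  refine ⟨|A| + B, fun x => ?_⟩
  rw [hf]
  have h1 : A * circleFract (x - p) ≤ |A| * 1 := by
    refine (le_abs_self _).trans ?_
    rw [abs_mul, abs_of_nonneg (circleFract_nonneg _)]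
    gcongr
    exact (circleFract_lt_one _).le
  have h2 := (le_abs_self _).trans (hB x (mem_univ _))
  linarith

theorem uniformlyErgodic (h : IsRoof A p f) {α : ℝ} (hα : Irrational α) : UniformlyErgodic α f := by
  obtain ⟨φ, hφ, hf⟩ := h.exists_eq
  rw [funext hf]
  have hc := continuous_of_coe hφ.continuous
  exact UniformlyErgodic.add (((uniformlyErgodic_circleFract hα).comp_sub _).const_mul A)
    (uniformlyErgodic_of_continuous hα hc)
    ((integrable_circleFract.comp_sub_right _).const_mul A) (integrable_of_continuous_circle hc)

theorem rotSum_bound (h : IsRoof A p f) {α : ℝ} (hα : Irrational α) {η : ℝ} (hη : 0 < η) :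
    ∃ N : ℕ, ∀ n ≥ N, ∀ x, |rotSum α f n x - n| ≤ η * n := by
  obtain ⟨N, hN⟩ := h.uniformlyErgodic hα η hη
  refine ⟨N, fun n hn x => ?_⟩
  have := hN n hn x
  rwa [h.integral_eq_one, smul_eq_mul, mul_one] at this

/-- Eventually `f^(n) ≥ n / 2`, uniformly in the base point. Applying this at `T^(-n) x` makes the
cocycle unbounded below as well, so the greatest index with value at most `s` exists. -/
theorem exists_cocycle (h : IsRoof A p f) {α : ℝ} (hα : Irrational α) (x : UnitAddCircle)
    (s : ℝ) : ∃ n : ℤ, cocycle (rotation α) f n x ≤ s ∧ s < cocycle (rotation α) f (n + 1) x := by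
  obtain ⟨N, hN⟩ := h.rotSum_bound hα (η := 1 / 2) (by norm_num)
  have hmono := cocycle_strictMono (rotation α) h.pos x
  have hlow : ∀ n : ℕ, N ≤ n → ∀ y, (n : ℝ) / 2 ≤ cocycle (rotation α) f n y := by
    intro n hn y
    have := abs_le.1 (hN n hn y)
    rw [cocycle_natCast]
    linarith
  obtain ⟨k, hk⟩ := exists_nat_ge (2 * |s| + 1)
  set n := max k N with hn
  have hn1 : 2 * |s| + 1 ≤ n := hk.trans (by exact_mod_cast le_max_left _ _)
  have hs := abs_le.1 (le_refl |s|)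
  obtain ⟨m, hm, hub⟩ := Int.exists_greatest_of_bdd
    (P := fun m => cocycle (rotation α) f m x ≤ s) ⟨n, fun m hm => by
      by_contra! hlt
      have h1 := hmono hlt
      have h2 := hlow n (le_max_right _ _) x
      simp only at h1
      linarith⟩ ⟨-n, by
      have h1 := cocycle_add (rotation α) f n (-n) x
      rw [add_neg_cancel, cocycle_zero] at h1
      have h2 := hlow n (le_max_right _ _) ((rotation α ^ (-(n : ℤ))) x)
      linarith⟩
  refine ⟨m, hm, ?_⟩
  by_contra! hlt
  have := hub _ hlt
  omega

theorem mem_flow_iff (h : IsRoof A p f) {α : ℝ} (hα : Irrational α) (t : ℝ) (z : Space f)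
    (B : Set (Space f)) :
    flow (rotation α) f t z ∈ B ↔ (z.1.1, z.1.2 + t) ∈ lift (rotation α) f B :=
  VonNeumannFlow.mem_flow_iff _ h.pos (h.exists_cocycle hα _ _) B

theorem measurable_rotSum {f : UnitAddCircle → ℝ} (hf : Measurable f) (α : ℝ) (n : ℕ) :
    Measurable (rotSum α f n) :=
  Finset.measurable_fun_sum _ fun _ _ => hf.comp (measurable_id.add_const _)

theorem measurable_cocycle (h : IsRoof A p f) (α : ℝ) (n : ℤ) :
    Measurable (cocycle (rotation α) f n) := by
  unfold cocycle
  simp only [rotation_zpow]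
  exact (Finset.measurable_fun_sum _ fun _ _ => h.measurable.comp (measurable_id.add_const _)).sub
    (Finset.measurable_fun_sum _ fun _ _ => h.measurable.comp (measurable_id.add_const _))

theorem measurableSet_region (h : IsRoof A p f) :
    MeasurableSet {z : UnitAddCircle × ℝ | 0 ≤ z.2 ∧ z.2 < f z.1} :=
  (measurableSet_le measurable_const measurable_snd).inter
    (measurableSet_lt measurable_snd (h.measurable.comp measurable_fst))

theorem measurableSet_image (h : IsRoof A p f) {B : Set (Space f)} (hB : MeasurableSet B) :
    MeasurableSet (Subtype.val '' B) :=
  MeasurableSet.subtype_image h.measurableSet_region hB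

theorem measurePreserving_shear {f : UnitAddCircle → ℝ} (hf : Measurable f) (a : UnitAddCircle) :
    MeasurePreserving (fun z : UnitAddCircle × ℝ => (z.1 + a, z.2 + f z.1)) := by
  refine (measurePreserving_add_right volume a).skew_product (g := fun x s => s + f x)
    (measurable_snd.add (hf.comp measurable_fst)) (ae_of_all _ fun x => ?_)
  exact (measurePreserving_add_right volume (f x)).map_eq

theorem measurePreserving_deck (h : IsRoof A p f) (α : ℝ) (n : ℤ) :
    MeasurePreserving (deck (rotation α) f n) := by
  have := measurePreserving_shear (h.measurable_cocycle α n).neg ((n * α : ℝ) : UnitAddCircle)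
  convert this using 2 with z
  simp [deck, rotation_zpow, sub_eq_add_neg]

theorem measurableSet_lift (h : IsRoof A p f) (α : ℝ) {B : Set (Space f)} (hB : MeasurableSet B) :
    MeasurableSet (lift (rotation α) f B) :=
  MeasurableSet.iUnion fun n =>
    (h.measurePreserving_deck α n).measurable (h.measurableSet_image hB)

theorem measurePreserving_vshift (t : ℝ) :
    MeasurePreserving (fun z : UnitAddCircle × ℝ => (z.1, z.2 + t)) := by
  simpa using measurePreserving_shear (f := fun _ => t) measurable_const 0

theorem measurable_flow (h : IsRoof A p f) {α : ℝ} (hα : Irrational α) (t : ℝ) :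
    Measurable (flow (rotation α) f t) := by
  intro B hB
  have : flow (rotation α) f t ⁻¹' B
      = (fun z : Space f => (z.1.1, z.1.2 + t)) ⁻¹' lift (rotation α) f B := by
    ext z
    exact h.mem_flow_iff hα t z B
  rw [this]
  exact ((measurePreserving_vshift t).measurable.comp measurable_subtype_coe) (h.measurableSet_lift α hB)

theorem spaceMeasure_apply (h : IsRoof A p f) {B : Set (Space f)} (hB : MeasurableSet B) :
    spaceMeasure volume f B = volume (Subtype.val '' B) :=
  Measure.comap_apply _ Subtype.val_injective (fun _ hs => h.measurableSet_image hs) _ hB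

theorem spaceMeasure_univ_lt_top (h : IsRoof A p f) : spaceMeasure volume f univ < ⊤ := by
  obtain ⟨M, hM⟩ := h.exists_bound
  rw [h.spaceMeasure_apply MeasurableSet.univ]
  have : (Subtype.val '' (univ : Set (Space f)) : Set (UnitAddCircle × ℝ)) ⊆ univ ×ˢ Icc 0 M := by
    rintro _ ⟨z, _, rfl⟩
    exact ⟨mem_univ _, z.2.1, z.2.2.le.trans (hM _)⟩
  refine (measure_mono this).trans_lt ?_
  rw [Measure.volume_eq_prod, Measure.prod_prod]
  simp

/-- Correlations become measures of sets in the plane-like cover, without any choice of index; both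
the upper and the lower bound start from this form. -/
theorem spaceMeasure_inter_flow (h : IsRoof A p f) {α : ℝ} (hα : Irrational α) (t : ℝ)
    {B C : Set (Space f)} (hB : MeasurableSet B) (hC : MeasurableSet C) :
    spaceMeasure volume f (B ∩ flow (rotation α) f t ⁻¹' C)
      = volume {z : UnitAddCircle × ℝ |
          z ∈ Subtype.val '' B ∧ (z.1, z.2 + t) ∈ lift (rotation α) f C} := by
  rw [h.spaceMeasure_apply (hB.inter (h.measurable_flow hα t hC))]
  congr 1
  ext z
  constructor
  · rintro ⟨w, ⟨hw, hw'⟩, rfl⟩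
    exact ⟨⟨w, hw, rfl⟩, (h.mem_flow_iff hα t w C).1 hw'⟩
  · rintro ⟨⟨w, hw, rfl⟩, hw'⟩
    exact ⟨w, ⟨hw, (h.mem_flow_iff hα t w C).2 hw'⟩, rfl⟩

/-- Preservation of null sets is what inverting an isomorphism requires. It holds because a null set
lifts to a countable union of null deck preimages. -/
theorem quasiMeasurePreserving_flow (h : IsRoof A p f) {α : ℝ} (hα : Irrational α) (t : ℝ) :
    Measure.QuasiMeasurePreserving (flow (rotation α) f t) (spaceMeasure volume f)
      (spaceMeasure volume f) := by
  refine ⟨h.measurable_flow hα t, Measure.AbsolutelyContinuous.mk fun N hN h0 => ?_⟩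
  rw [Measure.map_apply (h.measurable_flow hα t) hN, ← univ_inter (flow _ _ _ ⁻¹' N),
    h.spaceMeasure_inter_flow hα t MeasurableSet.univ hN]
  rw [h.spaceMeasure_apply hN] at h0
  have hl : volume (lift (rotation α) f N) = 0 := by
    refine measure_iUnion_null fun n => ?_
    rw [(h.measurePreserving_deck α n).measure_preimage (h.measurableSet_image hN).nullMeasurableSet,
      h0]
  refine measure_mono_null (t := (fun z : UnitAddCircle × ℝ => (z.1, z.2 + t)) ⁻¹'
    lift (rotation α) f N) (fun z hz => hz.2) ?_
  rw [(measurePreserving_vshift t).measure_preimage (h.measurableSet_lift α hN).nullMeasurableSet, hl]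

end IsRoof

/-! ### Upper bound: returns to a small box at large times. -/

/-- A set of reals that meets every subinterval free of the points of `C` in measure at most `a`
has measure at most `(#C + 1) a`. -/
theorem volume_inter_Ioo_le_of_cuts (W : Set ℝ) (C : Finset ℝ) (a : ENNReal) {x₀ y₀ : ℝ}
    (h : ∀ x y, x₀ ≤ x → y ≤ y₀ → (∀ c ∈ C, c ∉ Ioo x y) → volume (W ∩ Ioo x y) ≤ a) :
    volume (W ∩ Ioo x₀ y₀) ≤ (C.card + 1) * a := by
  induction C using Finset.induction_on_max generalizing y₀ with
  | empty => simpa using h x₀ y₀ le_rfl le_rfl (by simp)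
  | insert c C hmax ih =>
    have hcC : c ∉ C := fun hc => lt_irrefl _ (hmax c hc)
    rw [Finset.card_insert_of_notMem hcC]
    push_cast
    rcases le_or_gt y₀ c with hc | hc
    · refine (ih fun x y hx hy hC => h x y hx hy ?_).trans ?_
      · intro d hd
        rcases Finset.mem_insert.1 hd with rfl | hd
        · exact fun hd => (hd.2.trans_le (hy.trans hc)).false
        · exact hC d hd
      · gcongr
        exact le_self_add
    -- Cut at the largest point `c`: the left part is handled by induction, the right part contains
    -- no cut. The maximum covers the case where `c` lies to the left of `x₀`.
    · have hsub : W ∩ Ioo x₀ y₀ ⊆ (W ∩ Ioo x₀ c) ∪ ({c} ∪ (W ∩ Ioo (max x₀ c) y₀)) := by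
        rintro u ⟨hu, hu1, hu2⟩
        rcases lt_trichotomy u c with h | h | h
        · exact Or.inl ⟨hu, hu1, h⟩
        · exact Or.inr (Or.inl h)
        · exact Or.inr (Or.inr ⟨hu, max_lt hu1 h, hu2⟩)
      have h1 : volume (W ∩ Ioo x₀ c) ≤ (C.card + 1) * a := by
        refine ih fun x y hx hy hC => h x y hx (hy.trans hc.le) ?_
        intro d hd
        rcases Finset.mem_insert.1 hd with rfl | hd
        · exact fun hd => (hd.2.trans_le hy).false
        · exact hC d hd
      have h2 : volume (W ∩ Ioo (max x₀ c) y₀) ≤ a := by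
        refine h _ _ (le_max_left _ _) le_rfl fun d hd hd' => ?_
        have h3 := (le_max_right x₀ c).trans_lt hd'.1
        rcases Finset.mem_insert.1 hd with rfl | hd
        · exact lt_irrefl _ h3
        · exact (h3.trans (hmax d hd)).false
      calc volume (W ∩ Ioo x₀ y₀)
          ≤ volume (W ∩ Ioo x₀ c) + (volume {c} + volume (W ∩ Ioo (max x₀ c) y₀)) :=
            (measure_mono hsub).trans ((measure_union_le _ _).trans (by
              gcongr; exact measure_union_le _ _))
        _ ≤ (C.card + 1) * a + (0 + a) := by
            gcongr
            simp
        _ = (C.card + 1 + 1) * a := by ring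

theorem norm_coe_le_abs (x : ℝ) : ‖(x : UnitAddCircle)‖ ≤ |x| := by
  rw [UnitAddCircle.norm_eq]
  simpa using round_le x 0

theorem norm_intCast_mul_pos {α : ℝ} (hα : Irrational α) {m : ℤ} (hm : m ≠ 0) :
    0 < ‖((m * α : ℝ) : UnitAddCircle)‖ := by
  rw [norm_pos_iff]
  intro h
  obtain ⟨n, hn⟩ := (AddCircle.coe_eq_zero_iff 1).1 h
  rw [zsmul_eq_mul, mul_one] at hn
  exact (hα.intCast_mul hm).ne_int n hn.symm

/-- Short arcs have long return times under an irrational rotation. -/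
theorem eventually_return_time {α : ℝ} (hα : Irrational α) (M : ℕ) :
    ∀ᶠ ℓ in 𝓝[>] (0 : ℝ), ∀ m : ℤ, 0 < m → ‖((m * α : ℝ) : UnitAddCircle)‖ < 2 * ℓ → (M : ℤ) < m := by
  have : ∀ᶠ ℓ in 𝓝[>] (0 : ℝ), ∀ m ∈ Finset.Icc (1 : ℤ) M,
      2 * ℓ < ‖((m * α : ℝ) : UnitAddCircle)‖ := by
    rw [Finset.eventually_all]
    intro m hm
    have h1 : m ≠ 0 := by
      have := (Finset.mem_Icc.1 hm).1
      omega
    have h2 : Tendsto (fun ℓ : ℝ => 2 * ℓ) (𝓝[>] 0) (𝓝 0) := by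
      have : Continuous fun ℓ : ℝ => 2 * ℓ := by fun_prop
      simpa using (this.tendsto 0).mono_left nhdsWithin_le_nhds
    exact h2.eventually_lt_const (norm_intCast_mul_pos hα h1)
  filter_upwards [this] with ℓ hℓ m hm hlt
  by_contra! hle
  have := hℓ m (Finset.mem_Icc.2 ⟨by omega, hle⟩)
  linarith

/-- Between two points not separated by singularities the fractional parts move rigidly. -/
theorem fract_sub_fract {u v w : ℝ} (huv : u < v) (h : ∀ k : ℤ, (k : ℝ) - w ∉ Ioc u v) :
    Int.fract (v + w) - Int.fract (u + w) = v - u := by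
  have h1 : ⌊v + w⌋ = ⌊u + w⌋ := by
    refine le_antisymm ?_ (Int.floor_mono (by linarith))
    rw [Int.le_floor]
    by_contra! hlt
    exact h ⌊v + w⌋ ⟨by linarith, by linarith [Int.floor_le (v + w)]⟩
  rw [Int.fract, Int.fract, h1]
  ring

namespace IsRoof

variable {A p : ℝ} {f : UnitAddCircle → ℝ}

/-- The roof is right-continuous at `p`, so on short arcs starting there it stays above half of
`f(p)`; a low box over such an arc fits under the roof. -/
theorem eventually_le_on_arc (h : IsRoof A p f) :
    ∃ κ₀ > 0, ∀ᶠ ℓ in 𝓝[>] (0 : ℝ), ∀ x : UnitAddCircle,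
      circleFract (x - (p : UnitAddCircle)) < ℓ → κ₀ ≤ f x := by
  obtain ⟨φ, hφ, hf⟩ := h.exists_eq
  set F : ℝ → ℝ := fun y => A * y + φ ((y + p : ℝ) : UnitAddCircle) with hF
  have hfF : ∀ x : UnitAddCircle, f x = F (circleFract (x - (p : UnitAddCircle))) := by
    intro x
    simp only [hF, AddCircle.coe_add, coe_circleFract, sub_add_cancel]
    exact hf x
  have hFc : Continuous F :=
    (continuous_const.mul continuous_id).add
      (hφ.continuous.comp (continuous_id.add continuous_const))
  have hF0 : 0 < F 0 := by
    have := h.pos (p : UnitAddCircle)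
    rw [hfF, sub_self, ← AddCircle.coe_zero, circleFract_coe, Int.fract_zero] at this
    exact this
  refine ⟨F 0 / 2, by positivity, ?_⟩
  have hev : ∀ᶠ y in 𝓝 (0 : ℝ), F 0 / 2 < F y :=
    (hFc.tendsto 0).eventually_const_lt (by linarith)
  obtain ⟨δ, hδ, hball⟩ := Metric.eventually_nhds_iff.1 hev
  filter_upwards [Ioo_mem_nhdsGT hδ] with ℓ hℓ x hx
  rw [hfF]
  refine (hball ?_).le
  rw [Real.dist_eq, sub_zero, abs_of_nonneg (circleFract_nonneg _)]
  exact hx.trans hℓ.2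

/-- The base times `n` at which the orbit of `x` may be at height in `[0, κ)` at time `τ`. -/
theorem return_index_bounds (h : IsRoof A p f) {α : ℝ} (hα : Irrational α) {η κ : ℝ} (hη : 0 < η)
    (hη' : η ≤ 1 / 2) : ∃ t₀, ∀ τ ≥ t₀, ∀ (n : ℤ) (x : UnitAddCircle),
      0 ≤ τ - cocycle (rotation α) f n x → τ - cocycle (rotation α) f n x < κ →
      0 < n ∧ (1 - 2 * η) * τ ≤ n ∧ (n : ℝ) ≤ (1 + 2 * η) * τ := by
  obtain ⟨N, hN⟩ := h.rotSum_bound hα hη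
  -- The first bound gives `κ ≤ η τ`. The second excludes `n ≤ N`, since then `f^(n) ≤ f^(N+1) ≤ (1
  -- + η)(N + 1) ≤ τ - κ`.
  refine ⟨max (max 1 (κ / η)) ((1 + η) * (N + 1) + κ), fun τ hτ n x h1 h2 => ?_⟩
  have hτ1 : 1 ≤ τ := ((le_max_left _ _).trans (le_max_left _ _)).trans hτ
  have hτ2 : κ ≤ η * τ := by
    have := ((le_max_right 1 (κ / η)).trans (le_max_left _ _)).trans hτ
    rwa [div_le_iff₀ hη, mul_comm] at this
  have hτ3 : (1 + η) * (N + 1) + κ ≤ τ := (le_max_right _ _).trans hτ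
  have hn : ((N + 1 : ℕ) : ℤ) ≤ n := by
    by_contra! hlt
    have a1 := cocycle_strictMono (rotation α) h.pos x hlt
    have a2 := (abs_le.1 (hN (N + 1) (by omega) x)).2
    simp only [cocycle_natCast] at a1
    push_cast at a2
    linarith
  lift n to ℕ using by omega
  have hn' : N ≤ n := by omega
  have hb := abs_le.1 (hN n hn' x)
  rw [cocycle_natCast] at h1 h2
  push_cast
  refine ⟨by omega, ?_, ?_⟩
  · nlinarith
  · nlinarith

end IsRoof

namespace IsRoof

variable {A p : ℝ} {f : UnitAddCircle → ℝ}

/-- The drift of two nearby orbits not separated by the discontinuity is almost linear. -/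
theorem rotSum_drift (h : IsRoof A p f) {α : ℝ} (hα : Irrational α) {η : ℝ} (hη : 0 < η) :
    ∃ C : ℝ, 0 ≤ C ∧ ∀ (n : ℕ) (u v : ℝ), u < v →
      (∀ i < n, ∀ k : ℤ, (k : ℝ) - (i * α - p) ∉ Ioc u v) →
      |rotSum α f n (v : UnitAddCircle) - rotSum α f n (u : UnitAddCircle) - A * n * (v - u)|
        ≤ (η * n + C) * (v - u) := by
  obtain ⟨φ, hφ, hf⟩ := h.exists_eq
  obtain ⟨C, hC0, hC⟩ := rotSum_lipschitz hα hφ hη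
  refine ⟨C, hC0, fun n u v huv hs => ?_⟩
  have e : ∀ w : ℝ, rotSum α f n (w : UnitAddCircle)
      = A * ∑ i ∈ Finset.range n, Int.fract (w + (i * α - p)) + rotSum α φ n (w : UnitAddCircle) := by
    intro w
    rw [rotSum, rotSum, Finset.mul_sum, ← Finset.sum_add_distrib]
    refine Finset.sum_congr rfl fun i _ => ?_
    rw [hf, ← AddCircle.coe_add, ← AddCircle.coe_sub, circleFract_coe, add_sub_assoc]
  have e2 : ∑ i ∈ Finset.range n, Int.fract (v + (i * α - p))
      - ∑ i ∈ Finset.range n, Int.fract (u + (i * α - p)) = n * (v - u) := by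
    rw [← Finset.sum_sub_distrib, Finset.sum_congr rfl fun i hi =>
      fract_sub_fract huv (hs i (Finset.mem_range.1 hi))]
    rw [Finset.sum_const, Finset.card_range, nsmul_eq_mul]
  have := hC n v u
  rw [abs_of_pos (sub_pos.2 huv)] at this
  convert this using 2
  rw [e, e]
  linear_combination A * e2

/-- The numerator will count the pieces per unit of `ℓ τ`, the denominator will bound the drift from
below; the quotient tends to `1 / a` as `η → 0`. -/
theorem exists_small_parameter {a θ : ℝ} (ha : 0 < a) (hθ : 1 < θ) :
    ∃ η : ℝ, 0 < η ∧ η ≤ 1 / 4 ∧ 2 * η < a ∧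
      ((1 + η) * (1 + 3 * η) + 2 * η) / ((a - 2 * η) * (1 - 2 * η)) ≤ θ / a := by
  have hc : Tendsto (fun η : ℝ => ((1 + η) * (1 + 3 * η) + 2 * η) / ((a - 2 * η) * (1 - 2 * η)))
      (𝓝[>] 0) (𝓝 (1 / a)) := by
    have : ContinuousAt (fun η : ℝ => ((1 + η) * (1 + 3 * η) + 2 * η) / ((a - 2 * η) * (1 - 2 * η)))
        0 := by
      apply ContinuousAt.div (by fun_prop) (by fun_prop)
      simpa using ha.ne'
    have h2 := this.tendsto.mono_left (nhdsWithin_le_nhds (s := Ioi 0))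
    simpa using h2
  have h1 : ∀ᶠ η in 𝓝[>] (0 : ℝ),
      ((1 + η) * (1 + 3 * η) + 2 * η) / ((a - 2 * η) * (1 - 2 * η)) < θ / a :=
    hc.eventually_lt_const (by gcongr)
  have h2 : ∀ᶠ η in 𝓝[>] (0 : ℝ), η ∈ Ioo 0 (min (1 / 4) (a / 2)) :=
    Ioo_mem_nhdsGT (by positivity)
  obtain ⟨η, h1, h2, h3⟩ := (h1.and h2).exists
  have := lt_min_iff.1 h3
  exact ⟨η, h2, this.1.le, by linarith [this.2], h1.le⟩

/-- Real coordinates of the points of the arc `(p, p + ℓ)` whose orbit is over the arc, at height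
in `[0, κ)`, at time `τ`. -/
def returnSet (α p ℓ κ τ : ℝ) (f : UnitAddCircle → ℝ) : Set ℝ :=
  {u | u ∈ Ioo p (p + ℓ) ∧ ∃ n : ℤ,
    circleFract ((u : UnitAddCircle) + ((n * α : ℝ) : UnitAddCircle) - (p : UnitAddCircle)) < ℓ ∧
    0 ≤ τ - cocycle (rotation α) f n u ∧ τ - cocycle (rotation α) f n u < κ}

theorem norm_sub_lt_of_arc {x y c : UnitAddCircle} {ℓ : ℝ} (hx : circleFract (x - c) < ℓ)
    (hy : circleFract (y - c) < ℓ) : ‖x - y‖ < ℓ := by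
  have e : x - y = ((circleFract (x - c) - circleFract (y - c) : ℝ) : UnitAddCircle) := by
    rw [AddCircle.coe_sub, coe_circleFract, coe_circleFract, sub_sub_sub_cancel_right]
  rw [e]
  refine (norm_coe_le_abs _).trans_lt ?_
  rw [abs_lt]
  constructor <;> linarith [circleFract_nonneg (x - c), circleFract_nonneg (y - c)]

set_option maxHeartbeats 1600000 in
/-- The return set has small measure for large times. -/
theorem volume_returnSet_le (h : IsRoof A p f) {α : ℝ} (hα : Irrational α) {θ κ₁ : ℝ}
    (hθ : 1 < θ) (hκ₁ : 0 < κ₁) : ∃ κ ℓ : ℝ, 0 < κ ∧ κ ≤ κ₁ ∧ 0 < ℓ ∧ ℓ < 1 ∧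
      (∀ x : UnitAddCircle, circleFract (x - (p : UnitAddCircle)) < ℓ → κ ≤ f x) ∧
      ∃ t₀, ∀ τ ≥ t₀, volume (returnSet α p ℓ κ τ f) ≤ ENNReal.ofReal (θ * ℓ * κ / |A|) := by
  have hA : 0 < |A| := abs_pos.2 h.slope_ne_zero
  obtain ⟨η, hη, hη4, hηA, hηθ⟩ := exists_small_parameter hA hθ
  obtain ⟨C, hC0, hC⟩ := h.rotSum_drift hα hη
  obtain ⟨N, hN⟩ := h.rotSum_bound hα hη
  obtain ⟨κ₂, hκ₂, hev⟩ := h.eventually_le_on_arc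
  set κ := min κ₁ (min κ₂ 1) with hκ
  have hκ0 : 0 < κ := by positivity
  have hκ1 : κ ≤ 1 := (min_le_right _ _).trans (min_le_right _ _)
  -- Chosen so that `f^(k) ≥ k / 2` for `k > M` exceeds `κ ≤ 1` plus the largest drift `3 (|A| + 1)
  -- / (2 η)` inside a piece.
  obtain ⟨M₀, hM₀⟩ := exists_nat_ge (2 + 4 * (|A| + 1) / η)
  set M := max N M₀ with hM
  have hM1 : 2 + 4 * (|A| + 1) / η ≤ M := hM₀.trans (by exact_mod_cast le_max_right _ _)
  obtain ⟨ℓ, ⟨hℓarc, hℓret⟩, hℓ0, hℓ1⟩ := ((hev.and (eventually_return_time hα M)).and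
    (Ioo_mem_nhdsGT (zero_lt_one' ℝ))).exists
  refine ⟨κ, ℓ, hκ0, min_le_left _ _, hℓ0, hℓ1, fun x hx => ?_, ?_⟩
  · exact ((min_le_right _ _).trans (min_le_left _ _)).trans (hℓarc x hx)
  -- The singularities of the ergodic sums lie at `p - i α`, hence the rotation by `-α`.
  obtain ⟨N₃, hN₃⟩ := card_filter_circleFract_lt hα.neg hℓ0.le hℓ1 (mul_pos hη hℓ0)
  obtain ⟨t₁, ht₁⟩ := h.return_index_bounds hα (κ := κ) hη (by linarith)
  refine ⟨max t₁ (max (2 * C / η) (max N₃ (max (1 / η) (4 / (ℓ * η))))), fun τ hτ => ?_⟩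
  simp only [ge_iff_le, max_le_iff] at hτ
  obtain ⟨hτ1, hτC, hτN, hτη, hτℓ⟩ := hτ
  rw [div_le_iff₀ (by positivity)] at hτC hτη hτℓ
  have hτ0 : 0 < τ := by nlinarith
  set n₂ := ⌈(1 + 2 * η) * τ⌉₊ with hn₂
  have hn₂le : (n₂ : ℝ) ≤ (1 + 3 * η) * τ := by
    have := (Nat.ceil_lt_add_one (by positivity : 0 ≤ (1 + 2 * η) * τ)).le
    linarith
  have hn₂ge : (1 + 2 * η) * τ ≤ n₂ := Nat.le_ceil _
  have hn₂N : N₃ ≤ n₂ := by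
    have : (N₃ : ℝ) ≤ n₂ := by nlinarith
    exact_mod_cast this
  -- Besides the singularities `C₁`, a grid `C₂` of mesh `d` is cut out. It keeps the drift inside a
  -- piece bounded independently of `τ`, and adds only about `η ℓ τ` cuts.
  set d := 1 / (η * τ) with hd
  have hd0 : 0 < d := by positivity
  set C₁ : Finset ℝ := ((Finset.range n₂).filter fun i : ℕ =>
    circleFract (0 + ((i * -α : ℝ) : UnitAddCircle)) < ℓ).image
      fun i : ℕ => p + Int.fract (i * -α) with hC₁
  set C₂ : Finset ℝ := (Finset.range (⌈ℓ / d⌉₊ + 1)).image fun j : ℕ => p + j * d with hC₂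
  -- One `η` of the final `2 * η` pays for the grid, the other for the additive constant `3`,
  -- because `4 ≤ η ℓ τ`.
  have hcard : ((C₁ ∪ C₂).card : ℝ) + 1 ≤ ℓ * τ * ((1 + η) * (1 + 3 * η) + 2 * η) := by
    have h1 : (C₁.card : ℝ) ≤ (ℓ + η * ℓ) * n₂ :=
      (Nat.cast_le.2 Finset.card_image_le).trans (hN₃ n₂ hn₂N 0)
    have h2 : (C₂.card : ℝ) ≤ ℓ / d + 2 := by
      have a1 : C₂.card ≤ ⌈ℓ / d⌉₊ + 1 := Finset.card_image_le.trans (by simp)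
      have a2 := (Nat.ceil_lt_add_one (by positivity : 0 ≤ ℓ / d)).le
      have a3 : (C₂.card : ℝ) ≤ (⌈ℓ / d⌉₊ : ℝ) + 1 := by exact_mod_cast a1
      linarith
    have h3 : ((C₁ ∪ C₂).card : ℝ) ≤ C₁.card + C₂.card := by
      exact_mod_cast Finset.card_union_le _ _
    have h4 : ℓ / d = ℓ * (η * τ) := by rw [hd]; field_simp
    have h5 : (ℓ + η * ℓ) * n₂ ≤ (ℓ + η * ℓ) * ((1 + 3 * η) * τ) := by gcongr
    rw [h4] at h2
    nlinarith
  set a := κ / ((|A| - 2 * η) * ((1 - 2 * η) * τ)) with ha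
  have hη2 : 0 < 1 - 2 * η := by linarith
  have hA2 : 0 < |A| - 2 * η := by linarith
  have hlocal : ∀ x y, p ≤ x → y ≤ p + ℓ → (∀ c ∈ C₁ ∪ C₂, c ∉ Ioo x y) →
      volume (returnSet α p ℓ κ τ f ∩ Ioo x y) ≤ ENNReal.ofReal a := by
    intro x y hx hy hfree
    have hlen : y - x ≤ d := by
      by_contra! hlt
      -- The first grid point strictly to the right of `x` would lie in the piece if that were
      -- longer than `d`.
      set j := ⌊(x - p) / d⌋₊ + 1 with hj
      have hxd : 0 ≤ (x - p) / d := div_nonneg (by linarith) hd0.le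
      have j1 : (x - p) / d < j := by rw [hj]; push_cast; exact Nat.lt_floor_add_one _
      have j2 : (j : ℝ) ≤ (x - p) / d + 1 := by
        rw [hj]; push_cast; linarith [Nat.floor_le hxd]
      have j3 : x < p + j * d := by rw [div_lt_iff₀ hd0] at j1; linarith
      have j4 : p + j * d < y := by
        have : j * d ≤ ((x - p) / d + 1) * d := by gcongr
        rw [add_mul, div_mul_cancel₀ _ hd0.ne'] at this
        linarith
      have j5 : (j : ℝ) < ℓ / d := by rw [lt_div_iff₀ hd0]; linarith
      have j6 : j < ⌈ℓ / d⌉₊ + 1 := by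
        have : (j : ℝ) < ⌈ℓ / d⌉₊ := j5.trans_le (Nat.le_ceil _)
        have : j < ⌈ℓ / d⌉₊ := by exact_mod_cast this
        omega
      exact hfree (p + j * d) (Finset.mem_union_right _
        (Finset.mem_image.2 ⟨j, Finset.mem_range.2 j6, rfl⟩)) ⟨j3, j4⟩
    have hsing : ∀ u v, x < u → v < y → ∀ i < n₂, ∀ k : ℤ, (k : ℝ) - (i * α - p) ∉ Ioc u v := by
      intro u v hu hv i hi k hk
      have e : Int.fract ((i : ℝ) * -α) = k - i * α := by
        rw [Int.fract_eq_iff]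
        exact ⟨by linarith [hk.1], by linarith [hk.2], -k, by push_cast; ring⟩
      refine hfree (p + Int.fract ((i : ℝ) * -α)) (Finset.mem_union_left _
        (Finset.mem_image.2 ⟨i, Finset.mem_filter.2 ⟨Finset.mem_range.2 hi, ?_⟩, rfl⟩)) ?_
      · rw [zero_add, circleFract_coe, e]
        linarith [hk.2]
      · rw [e]
        constructor <;> linarith [hk.1, hk.2]
    have hdrift : ∀ u v, x < u → u < v → v < y → ∀ n : ℕ, (1 - 2 * η) * τ ≤ n →
        (n : ℝ) ≤ (1 + 2 * η) * τ →
        |rotSum α f n (v : UnitAddCircle) - rotSum α f n (u : UnitAddCircle) - A * n * (v - u)|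
          ≤ 2 * η * n * (v - u) := by
      intro u v hu huv hv n hn1 hn2
      have hnn : n ≤ n₂ := by exact_mod_cast hn2.trans hn₂ge
      refine (hC n u v huv fun i hi => hsing u v hu hv i (hi.trans_le hnn)).trans ?_
      have : 0 ≤ v - u := by linarith
      gcongr
      nlinarith
    have hdist : ∀ w w', w ∈ Ioo x y → w' ∈ Ioo x y → ∀ n : ℕ, (1 - 2 * η) * τ ≤ n →
        (n : ℝ) ≤ (1 + 2 * η) * τ →
        |rotSum α f n (w' : UnitAddCircle) - rotSum α f n (w : UnitAddCircle)|
          ≤ (|A| + 2 * η) * n * |w' - w| := by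
      have hlt : ∀ w w', w ∈ Ioo x y → w' ∈ Ioo x y → w < w' → ∀ n : ℕ, (1 - 2 * η) * τ ≤ n →
          (n : ℝ) ≤ (1 + 2 * η) * τ →
          |rotSum α f n (w' : UnitAddCircle) - rotSum α f n (w : UnitAddCircle)|
            ≤ (|A| + 2 * η) * n * |w' - w| := by
        intro w w' hw hw' hww n hn1 hn2
        have h1 := hdrift w w' hw.1 hww hw'.2 n hn1 hn2
        have h2 := abs_sub_abs_le_abs_sub
          (rotSum α f n (w' : UnitAddCircle) - rotSum α f n (w : UnitAddCircle)) (A * n * (w' - w))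
        rw [abs_mul, abs_mul, Nat.abs_cast] at h2
        rw [abs_of_pos (sub_pos.2 hww)] at h2 ⊢
        linarith
      intro w w' hw hw' n hn1 hn2
      rcases lt_trichotomy w w' with hww | rfl | hww
      · exact hlt w w' hw hw' hww n hn1 hn2
      · simp
      · rw [abs_sub_comm, abs_sub_comm w' w]
        exact hlt w' w hw' hw hww n hn1 hn2
    -- Returns from one piece share the same index. If the indices differ by `k`, the base points
    -- and their images each lie in an arc of length `ℓ`, so `‖k α‖ < 2 ℓ` and `k > M`; then `f^(k)`
    -- outgrows the drift plus the window.
    have hsep : ∀ w w', w ∈ Ioo x y → w' ∈ Ioo x y → ∀ n n' : ℕ,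
        (1 - 2 * η) * τ ≤ n → (n : ℝ) ≤ (1 + 2 * η) * τ →
        circleFract ((w : UnitAddCircle) + ((n * α : ℝ) : UnitAddCircle) - (p : UnitAddCircle)) < ℓ →
        circleFract ((w' : UnitAddCircle) + ((n' * α : ℝ) : UnitAddCircle) - (p : UnitAddCircle))
          < ℓ → τ - rotSum α f n w < κ → 0 ≤ τ - rotSum α f n' w' → n' ≤ n := by
      intro w w' hw hw' n n' hn1 hn2 hr hr' hs hs'
      by_contra! hlt
      obtain ⟨m, rfl⟩ := Nat.exists_eq_add_of_lt hlt
      rw [add_assoc] at hr' hs'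
      set k := m + 1 with hk
      have hww : |w' - w| < ℓ := by
        rw [abs_lt]
        constructor <;> linarith [hw.1, hw.2, hw'.1, hw'.2]
      have hnorm : ‖(((k : ℤ) * α : ℝ) : UnitAddCircle)‖ < 2 * ℓ := by
        have e : (((k : ℤ) * α : ℝ) : UnitAddCircle)
            = ((w' : UnitAddCircle) + (((n + k : ℕ) * α : ℝ) : UnitAddCircle)
              - ((w : UnitAddCircle) + ((n * α : ℝ) : UnitAddCircle)))
              - ((w' - w : ℝ) : UnitAddCircle) := by
          simp only [← AddCircle.coe_add, ← AddCircle.coe_sub]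
          push_cast
          ring_nf
        rw [e]
        have h1 := norm_sub_lt_of_arc hr' hr
        have h2 := (norm_coe_le_abs (w' - w)).trans_lt hww
        exact (norm_sub_le _ _).trans_lt (by linarith)
      have hkM : (M : ℤ) < k := hℓret k (by omega) hnorm
      have hkM' : (M : ℝ) ≤ k := by exact_mod_cast hkM.le
      have hkN : N ≤ k := by
        have : N ≤ M := le_max_left _ _
        omega
      have hsum : rotSum α f (n + k) (w' : UnitAddCircle) = rotSum α f n w'
          + rotSum α f k ((w' : UnitAddCircle) + ((n * α : ℝ) : UnitAddCircle)) := by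
        have := cocycle_add (rotation α) f k n (w' : UnitAddCircle)
        rw [rotation_zpow, ← Nat.cast_add, cocycle_natCast, cocycle_natCast, cocycle_natCast] at this
        rw [add_comm n k]
        simpa using this
      have hb := (abs_le.1 (hN k hkN
        ((w' : UnitAddCircle) + ((n * α : ℝ) : UnitAddCircle)))).1
      have hdr := (abs_le.1 (hdist w w' hw hw' n hn1 hn2)).1
      have hwd : |w' - w| ≤ d := by
        rw [abs_le]
        constructor <;> linarith [hw.1, hw.2, hw'.1, hw'.2]
      have hbd : (|A| + 2 * η) * n * |w' - w| ≤ (|A| + 1) * ((3 / 2) * τ) * d := by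
        gcongr
        · linarith
        · refine hn2.trans ?_
          gcongr
          linarith
      have hbd2 : (|A| + 1) * ((3 / 2) * τ) * d = 3 / 2 * ((|A| + 1) / η) := by
        rw [hd]; field_simp
      have h4 : 2 + 4 * ((|A| + 1) / η) ≤ k := by
        have : 4 * (|A| + 1) / η = 4 * ((|A| + 1) / η) := by ring
        linarith
      have h5 : 0 < (|A| + 1) / η := by positivity
      have h6 : (k : ℝ) / 2 ≤ k - η * k := by nlinarith
      linarith
    have hlt : ∀ u v, u ∈ returnSet α p ℓ κ τ f ∩ Ioo x y →
        v ∈ returnSet α p ℓ κ τ f ∩ Ioo x y → u < v → v - u ≤ a := by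
      rintro u v ⟨⟨_, n, hr, h0, hκn⟩, hu⟩ ⟨⟨_, n', hr', h0', hκn'⟩, hv⟩ huv
      obtain ⟨b1, b2, b3⟩ := ht₁ τ hτ1 n u h0 hκn
      obtain ⟨b1', b2', b3'⟩ := ht₁ τ hτ1 n' v h0' hκn'
      lift n to ℕ using b1.le
      lift n' to ℕ using b1'.le
      rw [cocycle_natCast] at h0 hκn h0' hκn'
      rw [Int.cast_natCast] at b2 b3 b2' b3' hr hr'
      have e1 := hsep u v hu hv n n' b2 b3 hr hr' hκn h0'
      have e2 := hsep v u hv hu n' n b2' b3' hr' hr hκn' h0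
      obtain rfl : n = n' := le_antisymm e2 e1
      have h1 := hdrift u v hu.1 huv hv.2 n b2 b3
      have h2 := abs_sub_abs_le_abs_sub (A * n * (v - u))
        (rotSum α f n (v : UnitAddCircle) - rotSum α f n (u : UnitAddCircle))
      rw [abs_sub_comm (A * n * (v - u)), abs_mul, abs_mul, Nat.abs_cast,
        abs_of_pos (sub_pos.2 huv)] at h2
      -- With a common index both heights lie in `[0, κ)`, so the drift is at most `κ`; being almost
      -- `|A| n (v - u)`, it bounds `v - u`.
      have h3 : |rotSum α f n (v : UnitAddCircle) - rotSum α f n (u : UnitAddCircle)| ≤ κ := by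
        rw [abs_le]
        constructor <;> linarith
      rw [ha, le_div_iff₀ (by positivity)]
      have h4 : (v - u) * ((|A| - 2 * η) * ((1 - 2 * η) * τ)) ≤ (v - u) * ((|A| - 2 * η) * n) := by
        have : 0 ≤ v - u := by linarith
        gcongr
      linarith
    have ha0 : 0 ≤ a := by positivity
    refine (Real.volume_le_diam _).trans (Metric.ediam_le fun u hu v hv => ?_)
    rw [edist_dist]
    apply ENNReal.ofReal_le_ofReal
    rw [Real.dist_eq]
    rcases lt_trichotomy u v with huv | rfl | huv
    · rw [abs_sub_comm, abs_of_pos (sub_pos.2 huv)]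
      exact hlt u v hu hv huv
    · simpa using ha0
    · rw [abs_of_pos (sub_pos.2 huv)]
      exact hlt v u hv hu huv
  have hvol := volume_inter_Ioo_le_of_cuts _ _ _ hlocal
  have hsub : returnSet α p ℓ κ τ f ∩ Ioo p (p + ℓ) = returnSet α p ℓ κ τ f :=
    inter_eq_left.2 fun u hu => hu.1
  rw [hsub] at hvol
  refine hvol.trans ?_
  have ha0 : 0 ≤ a := by positivity
  rw [← Nat.cast_one, ← Nat.cast_add, ← ENNReal.ofReal_natCast, ← ENNReal.ofReal_mul (by positivity)]
  apply ENNReal.ofReal_le_ofReal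
  push_cast
  calc ((C₁ ∪ C₂).card + 1 : ℝ) * a
      ≤ ℓ * τ * ((1 + η) * (1 + 3 * η) + 2 * η) * a := by gcongr
    _ = ℓ * κ * (((1 + η) * (1 + 3 * η) + 2 * η) / ((|A| - 2 * η) * (1 - 2 * η))) := by
        rw [ha]; field_simp
    _ ≤ ℓ * κ * (θ / |A|) := by gcongr
    _ = θ * ℓ * κ / |A| := by ring

end IsRoof

namespace IsRoof

variable {A p : ℝ} {f : UnitAddCircle → ℝ}

/-- Correlations of a small box with itself at large times are at most those given by the density
`1 / |A|` of the vertical displacement. -/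
theorem exists_box_correlation_le (h : IsRoof A p f) {α : ℝ} (hα : Irrational α) {θ b : ℝ}
    (hθ : 1 < θ) (hb : 0 < b) : ∃ E : Set (Space f), MeasurableSet E ∧ ∃ V : ℝ, 0 < V ∧
      ENNReal.ofReal V ≤ ∫⁻ y in Ioo (-b) b,
        spaceMeasure volume f (E ∩ flow (rotation α) f y ⁻¹' E) ∧
      ∀ᶠ t in atTop, spaceMeasure volume f (E ∩ flow (rotation α) f t ⁻¹' E)
        ≤ ENNReal.ofReal (θ * V / |A|) := by
  obtain ⟨κ, ℓ, hκ, hκb, hℓ, hℓ1, hfκ, t₀, ht₀⟩ := h.volume_returnSet_le hα hθ hb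
  set arc : Set UnitAddCircle := {x | circleFract (x - (p : UnitAddCircle)) < ℓ} with harc
  have harcm : MeasurableSet arc :=
    measurableSet_lt (measurable_circleFract.comp (measurable_id.sub_const _)) measurable_const
  set E : Set (Space f) := {z | z.1.1 ∈ arc ∧ z.1.2 < κ} with hE
  have hEm : MeasurableSet E :=
    (harcm.preimage (measurable_fst.comp measurable_subtype_coe)).inter
      (measurableSet_lt (measurable_snd.comp measurable_subtype_coe) measurable_const)
  have hEimg : Subtype.val '' E = arc ×ˢ Ico 0 κ := by
    ext z
    constructor
    · rintro ⟨w, ⟨hw1, hw2⟩, rfl⟩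
      exact ⟨hw1, w.2.1, hw2⟩
    · rintro ⟨hz1, hz2, hz3⟩
      exact ⟨⟨z, hz2, hz3.trans_le (hfκ _ hz1)⟩, ⟨hz1, hz3⟩, rfl⟩
  -- The fundamental domain `Ioc p (p + 1)` represents the left end of the arc by `p + 1`, a null
  -- set.
  have hpre : (fun x : ℝ => (x : UnitAddCircle)) ⁻¹' arc ∩ Ioc p (p + 1) ⊆
      Ioo p (p + ℓ) ∪ {p + 1} := by
    rintro u ⟨hu, hu1, hu2⟩
    rcases hu2.lt_or_eq with hu2 | rfl
    · left
      simp only [harc, mem_preimage, mem_ofPred_eq, ← AddCircle.coe_sub, circleFract_coe] at hu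
      rw [Int.fract_eq_self.2 ⟨by linarith, by linarith⟩] at hu
      exact ⟨hu1, by linarith⟩
    · right; rfl
  have hslice : ∀ (W : Set UnitAddCircle), MeasurableSet W → W ⊆ arc →
      volume W ≤ volume ((fun x : ℝ => (x : UnitAddCircle)) ⁻¹' W ∩ Ioo p (p + ℓ)) := by
    intro W hW hWa
    rw [← (UnitAddCircle.measurePreserving_mk p).measure_preimage hW.nullMeasurableSet,
      Measure.restrict_apply (AddCircle.measurable_mk' hW)]
    have hsub : (fun x : ℝ => (x : UnitAddCircle)) ⁻¹' W ∩ Ioc p (p + 1) ⊆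
        ((fun x : ℝ => (x : UnitAddCircle)) ⁻¹' W ∩ Ioo p (p + ℓ)) ∪ {p + 1} := by
      intro u hu
      rcases hpre ⟨hWa hu.1, hu.2⟩ with h | h
      · exact Or.inl ⟨hu.1, h⟩
      · exact Or.inr h
    exact (measure_mono hsub).trans ((measure_union_le _ _).trans (by simp))
  -- `ℓ κ²` is the integral over `|y| < κ` of `ℓ (κ - |y|)`, the overlap of the box with its
  -- vertical translate by `y`.
  refine ⟨E, hEm, ℓ * κ ^ 2, by positivity, ?_, ?_⟩
  · have harcvol : ENNReal.ofReal ℓ ≤ volume arc := by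
      rw [← (UnitAddCircle.measurePreserving_mk p).measure_preimage harcm.nullMeasurableSet,
        Measure.restrict_apply (AddCircle.measurable_mk' harcm)]
      calc ENNReal.ofReal ℓ = volume (Ioo p (p + ℓ)) := by simp
        _ ≤ _ := by
          refine measure_mono fun u hu => ⟨?_, hu.1, by linarith [hu.2]⟩
          simp only [harc, mem_preimage, mem_ofPred_eq, ← AddCircle.coe_sub, circleFract_coe]
          rw [Int.fract_eq_self.2 ⟨by linarith [hu.1], by linarith [hu.2]⟩]
          linarith [hu.2]
    have hlow : ∀ y ∈ Ioo (-κ) κ, ENNReal.ofReal (ℓ * (κ - |y|)) ≤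
        spaceMeasure volume f (E ∩ flow (rotation α) f y ⁻¹' E) := by
      intro y hy
      have hsub : arc ×ˢ Ico (max 0 (-y)) (min κ (κ - y)) ⊆ {z : UnitAddCircle × ℝ |
          z ∈ Subtype.val '' E ∧ (z.1, z.2 + y) ∈ lift (rotation α) f E} := by
        rintro ⟨x, s⟩ ⟨hx, hs1, hs2⟩
        simp only [max_le_iff, lt_min_iff] at hs1 hs2
        constructor
        · rw [hEimg]
          exact ⟨hx, hs1.1, hs2.1⟩
        · refine mem_lift_of_mem _ _ ?_
          rw [hEimg]
          exact ⟨hx, by simp only; linarith, by simp only; linarith⟩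
      rw [h.spaceMeasure_inter_flow hα y hEm hEm]
      refine le_trans ?_ (measure_mono hsub)
      rw [Measure.volume_eq_prod, Measure.prod_prod, Real.volume_Ico,
        ENNReal.ofReal_mul hℓ.le]
      refine mul_le_mul' harcvol (ENNReal.ofReal_le_ofReal ?_)
      rcases le_total 0 y with h0 | h0
      · rw [abs_of_nonneg h0, max_eq_left (by linarith), min_eq_right (by linarith)]
        linarith
      · rw [abs_of_nonpos h0, max_eq_right (by linarith), min_eq_left (by linarith)]
    calc ENNReal.ofReal (ℓ * κ ^ 2)
        = ENNReal.ofReal (∫ y in Ioo (-κ) κ, ℓ * (κ - |y|)) := by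
          congr 1
          rw [← integral_Ioc_eq_integral_Ioo, ← intervalIntegral.integral_of_le (by linarith),
            intervalIntegral.integral_const_mul,
            ← intervalIntegral.integral_add_adjacent_intervals (b := 0)
              (Continuous.intervalIntegrable (by fun_prop) _ _)
              (Continuous.intervalIntegrable (by fun_prop) _ _)]
          have e1 : ∫ y in (-κ)..0, (κ - |y|) = ∫ y in (-κ)..0, (κ + y) := by
            refine intervalIntegral.integral_congr fun y hy => ?_
            rw [uIcc_of_le (by linarith)] at hy
            simp only [abs_of_nonpos hy.2, sub_neg_eq_add]
          have e2 : ∫ y in (0 : ℝ)..κ, (κ - |y|) = ∫ y in (0 : ℝ)..κ, (κ - y) := by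
            refine intervalIntegral.integral_congr fun y hy => ?_
            rw [uIcc_of_le (by linarith)] at hy
            simp only [abs_of_nonneg hy.1]
          rw [e1, e2, intervalIntegral.integral_add (by simp) (by simp),
            intervalIntegral.integral_sub (by simp) (by simp)]
          simp only [intervalIntegral.integral_const, integral_id, smul_eq_mul]
          ring
      _ = ∫⁻ y in Ioo (-κ) κ, ENNReal.ofReal (ℓ * (κ - |y|)) := by
          rw [ofReal_integral_eq_lintegral_ofReal]
          · exact (Continuous.integrableOn_Icc (by fun_prop)).mono_set Ioo_subset_Icc_self
          · refine (ae_restrict_iff' measurableSet_Ioo).2 (ae_of_all _ fun y hy => ?_)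
            have : |y| < κ := abs_lt.2 hy
            have : 0 ≤ κ - |y| := by linarith
            simp only [Pi.zero_apply]
            positivity
      _ ≤ ∫⁻ y in Ioo (-κ) κ, spaceMeasure volume f (E ∩ flow (rotation α) f y ⁻¹' E) :=
          setLIntegral_mono' measurableSet_Ioo hlow
      _ ≤ _ := lintegral_mono_set (Ioo_subset_Ioo (by linarith) hκb)
  · filter_upwards [eventually_ge_atTop t₀] with t ht
    rw [h.spaceMeasure_inter_flow hα t hEm hEm]
    set Q : Set (UnitAddCircle × ℝ) := {z : UnitAddCircle × ℝ |
          z ∈ Subtype.val '' E ∧ (z.1, z.2 + t) ∈ lift (rotation α) f E} with hQ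
    have hQm : MeasurableSet Q :=
      (h.measurableSet_image hEm).inter
        ((measurePreserving_vshift t).measurable (h.measurableSet_lift α hEm))
    rw [Measure.volume_eq_prod, Measure.prod_apply_symm hQm]
    -- The slice at height `s` lies, up to a null set, in the return set for the time `s + t ≥ t₀`.
    calc ∫⁻ s, volume ((fun x => (x, s)) ⁻¹' Q)
        ≤ ∫⁻ s, (Ico 0 κ).indicator (fun _ => ENNReal.ofReal (θ * ℓ * κ / |A|)) s := by
          refine lintegral_mono fun s => ?_
          by_cases hs : s ∈ Ico 0 κ
          · rw [indicator_of_mem hs]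
            refine (hslice _ (measurable_prodMk_right hQm) fun x hx => ?_).trans
              ((measure_mono ?_).trans (ht₀ (s + t) (by linarith [hs.1])))
            · have := hx.1
              rw [hEimg] at this
              exact this.1
            · rintro u ⟨hu, hu'⟩
              refine ⟨hu', ?_⟩
              obtain ⟨n, hn⟩ := mem_iUnion.1 hu.2
              rw [mem_preimage, hEimg, deck, rotation_zpow] at hn
              exact ⟨n, hn.1, hn.2.1, hn.2.2⟩
          · rw [indicator_of_notMem hs, nonpos_iff_eq_zero]
            have : (fun x => (x, s)) ⁻¹' Q = ∅ := by
              rw [eq_empty_iff_forall_notMem]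
              intro x hx
              have := hx.1
              rw [hEimg] at this
              exact hs this.2
            rw [this, measure_empty]
      _ = ENNReal.ofReal (θ * (ℓ * κ ^ 2) / |A|) := by
          rw [lintegral_indicator_const measurableSet_Ico, Real.volume_Ico, sub_zero,
            ← ENNReal.ofReal_mul' hκ.le]
          congr 1
          ring

end IsRoof

/-! ### Good rational approximations. -/

/-- A reduced approximation `P / d` of `α` of quality `1 / d ^ 2` but not `1 / (2 d ^ 2)` has a
neighbour of quality `1 / (2 q ^ 2)`. -/
theorem exists_neighbour_approximation {α : ℝ} {d : ℕ} {P : ℤ} (hd : 0 < d)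
    (hc : IsCoprime (d : ℤ) P) (h1 : |d * α - P| * d < 1) (h2 : 1 / 2 ≤ |d * α - P| * d) :
    ∃ (q : ℕ) (P' : ℤ), 0 < q ∧ IsCoprime (q : ℤ) P' ∧ |q * α - P'| ≤ 1 / (2 * q) ∧
      |q * α - P'| ≤ 1 / d := by
  have hd' : (0 : ℝ) < d := by exact_mod_cast hd
  set v := d * α - P with hv
  obtain ⟨s, hs, hsv⟩ : ∃ s : ℤ, (s = 1 ∨ s = -1) ∧ v = -s * |v| := by
    rcases le_total 0 v with h | h
    · exact ⟨-1, Or.inr rfl, by rw [abs_of_nonneg h]; push_cast; ring⟩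
    · exact ⟨1, Or.inl rfl, by rw [abs_of_nonpos h]; push_cast; ring⟩
  obtain ⟨a, b, hab⟩ := hc
  -- Since `b` inverts `P` modulo `d`, `q = d - r` satisfies `q P ≡ s` modulo `d`. This gives a
  -- fraction at determinant `±1` from `P / d`, with `s` chosen so that the two errors partly
  -- cancel.
  set r := (-s * b) % d with hr
  have hr0 : 0 ≤ r := Int.emod_nonneg _ (by omega)
  have hrd : r < d := Int.emod_lt_of_pos _ (by omega)
  obtain ⟨P', hP'⟩ : (d : ℤ) ∣ (d - r) * P - s := by
    have e := Int.mul_ediv_add_emod (-s * b) d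
    rw [← hr] at e
    refine ⟨P + ((-s * b) / d) * P - s * a, ?_⟩
    linear_combination (-P) * e + s * hab
  obtain ⟨q, hq⟩ := Int.eq_ofNat_of_zero_le (a := d - r) (by omega)
  rw [hq] at hP'
  have hq0 : 0 < q := by omega
  have hqd : q ≤ d := by omega
  have hq0' : (0 : ℝ) < q := by exact_mod_cast hq0
  have hqd' : (q : ℝ) ≤ d := by exact_mod_cast hqd
  have hs2 : (s : ℝ) * s = 1 := by rcases hs with rfl | rfl <;> norm_num
  have hsabs : |(s : ℝ)| = 1 := by rcases hs with rfl | rfl <;> norm_num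
  have hP'' : (q : ℝ) * P - s = d * P' := by exact_mod_cast hP'
  have e : d * (q * α - P') = s * (1 - q * |v|) := by
    have : d * (q * α - P') = q * v + s := by rw [hv]; linear_combination hP''
    rw [this, hsv, abs_mul, abs_neg, hsabs, one_mul, abs_abs]
    ring
  have hqv : q * |v| ≤ 1 := by nlinarith [abs_nonneg v]
  have habs : d * |q * α - P'| = 1 - q * |v| := by
    rw [← abs_of_pos hd', ← abs_mul, e, abs_mul, hsabs, one_mul, abs_of_nonneg (by linarith)]
  refine ⟨q, P', hq0, ?_, ?_, ?_⟩
  · rcases hs with rfl | rfl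
    · exact ⟨P, -d, by linear_combination hP'⟩
    · exact ⟨-P, d, by linear_combination -hP'⟩
  · rw [le_div_iff₀ (by positivity)]
    have : d * (|q * α - P'| * (2 * q)) ≤ d * 1 := by
      have e2 : d * (|q * α - P'| * (2 * q)) = 2 * q * (1 - q * |v|) := by rw [← habs]; ring
      rw [e2]
      -- With `x = q / d` the quality of the neighbour is at most `x (1 - x / 2) ≤ 1 / 2`, which is
      -- `(1 - x)² ≥ 0`.
      have h3 : (q : ℝ) ^ 2 / 2 ≤ q ^ 2 * (|v| * d) := by nlinarith [sq_nonneg (q : ℝ)]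
      have h4 : d * (2 * q * (1 - q * |v|)) ≤ d * d := by
        nlinarith [sq_nonneg ((d : ℝ) - q)]
      rw [mul_one]
      exact le_of_mul_le_mul_left h4 hd'
    exact le_of_mul_le_mul_left this hd'
  · rw [le_div_iff₀ hd', mul_comm, habs]
    have := mul_nonneg hq0'.le (abs_nonneg v)
    linarith

theorem norm_coe_mul_le (α : ℝ) (q : ℤ) (P : ℤ) :
    ‖((q * α : ℝ) : UnitAddCircle)‖ ≤ |q * α - P| := by
  have e : ((q * α : ℝ) : UnitAddCircle) = ((q * α - P : ℝ) : UnitAddCircle) := by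
    have h0 : ((P : ℝ) : UnitAddCircle) = 0 := (AddCircle.coe_eq_zero_iff 1).2 ⟨P, by simp⟩
    rw [AddCircle.coe_sub, h0, sub_zero]
  rw [e]
  exact norm_coe_le_abs _

/-- Dirichlet's theorem gives quality below `1`; if it exceeds `1 / 2`, pass to the neighbouring
fraction. Small `‖q α‖` forces `q` to be large. This is used at two scales, since the neighbour's
error is controlled only by the size of the original denominator. -/
theorem exists_good_denominator {α : ℝ} (hα : Irrational α) (Q : ℕ) :
    ∃ (q : ℕ) (P : ℤ), Q < q ∧ IsCoprime (q : ℤ) P ∧ |q * α - P| ≤ 1 / (2 * q) := by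
  obtain ⟨ℓ, hℓ, hℓ0⟩ := ((eventually_return_time hα Q).and self_mem_nhdsWithin).exists
  replace hℓ0 : 0 < ℓ := hℓ0
  obtain ⟨R, hR⟩ := exists_nat_gt (1 / (2 * ℓ))
  obtain ⟨ℓ', hℓ', hℓ'0⟩ := ((eventually_return_time hα R).and self_mem_nhdsWithin).exists
  replace hℓ'0 : 0 < ℓ' := hℓ'0
  obtain ⟨n, hn⟩ := exists_nat_gt (1 / (2 * ℓ) + 1 / (2 * ℓ'))
  have hp1 : 0 < 1 / (2 * ℓ) := by positivity
  have hp2 : 0 < 1 / (2 * ℓ') := by positivity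
  have hn0 : 0 < n := by
    have : (0 : ℝ) < n := by linarith
    exact_mod_cast this
  obtain ⟨r, hr, hrn⟩ := Real.exists_rat_abs_sub_le_and_den_le α hn0
  have hd0 : (0 : ℝ) < r.den := by exact_mod_cast r.den_pos
  have hv : |r.den * α - r.num| ≤ 1 / (n + 1) := by
    have e : r.den * α - r.num = r.den * (α - r) := by
      have h0 : (r : ℝ) * r.den = r.num := by exact_mod_cast r.mul_den_eq_num
      rw [mul_sub, ← h0]; ring
    rw [e, abs_mul, abs_of_pos hd0]
    calc (r.den : ℝ) * |α - r| ≤ r.den * (1 / ((n + 1) * r.den)) := by gcongr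
      _ = 1 / (n + 1) := by field_simp
  have hsmall : ∀ z : ℝ, 0 < z → 1 / (2 * z) < n → 1 / ((n : ℝ) + 1) < 2 * z := by
    intro z hz h
    rw [div_lt_iff₀ (by positivity)] at h ⊢
    linarith
  have hcop : IsCoprime (r.den : ℤ) r.num :=
    (Int.isCoprime_iff_gcd_eq_one.2 (by simpa [Int.gcd] using r.reduced)).symm
  by_cases hθ : |r.den * α - r.num| * r.den ≤ 1 / 2
  · refine ⟨r.den, r.num, ?_, hcop, ?_⟩
    · have := hℓ r.den (by exact_mod_cast r.den_pos) ((norm_coe_mul_le α r.den r.num).trans_lt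
        (hv.trans_lt (hsmall ℓ hℓ0 (by linarith))))
      exact_mod_cast this
    · rw [le_div_iff₀ (by positivity)]
      linarith
  · have hlt : |r.den * α - r.num| * r.den < 1 := by
      have hrn' : (r.den : ℝ) ≤ n := by exact_mod_cast hrn
      have : |r.den * α - r.num| * r.den ≤ 1 / (n + 1) * n := by gcongr
      refine this.trans_lt ?_
      rw [one_div_mul_eq_div, div_lt_one (by positivity)]
      linarith
    obtain ⟨q, P', hq0, hc, h1, h2⟩ := exists_neighbour_approximation r.den_pos hcop hlt
      (not_le.1 hθ).le
    refine ⟨q, P', ?_, hc, h1⟩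
    have hRd : (R : ℤ) < r.den := hℓ' r.den (by exact_mod_cast r.den_pos)
      ((norm_coe_mul_le α r.den r.num).trans_lt (hv.trans_lt (hsmall ℓ' hℓ'0 (by linarith))))
    have hRd' : (R : ℝ) < r.den := by exact_mod_cast hRd
    have h3 : 1 / (r.den : ℝ) < 2 * ℓ := by
      rw [div_lt_iff₀ (by positivity)] at hR ⊢
      nlinarith
    have := hℓ q (by exact_mod_cast hq0) ((norm_coe_mul_le α q P').trans_lt (h2.trans_lt h3))
    exact_mod_cast this

/-! ### Ergodic sums whose length is a good denominator. -/

theorem injOn_emod {q : ℕ} {P : ℤ} (hc : IsCoprime (q : ℤ) P) (j : ℤ) :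
    InjOn (fun i : ℕ => (j + i * P) % q) (Finset.range q) := by
  intro i hi i' hi' h
  have h1 : (q : ℤ) ∣ (j + i * P) - (j + i' * P) :=
    Int.ModEq.dvd (n := (q : ℤ)) (a := j + i' * P) (b := j + i * P) h.symm
  have h2 : (q : ℤ) ∣ (i - i') * P := by
    convert h1 using 1
    ring
  have h3 : (q : ℤ) ∣ i - i' := hc.dvd_of_dvd_mul_right h2
  have := Finset.mem_range.1 hi
  have := Finset.mem_range.1 hi'
  have h4 := Int.eq_zero_of_abs_lt_dvd h3 (by rw [abs_lt]; omega)
  omega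

theorem image_emod {q : ℕ} {P : ℤ} (hq : 0 < q) (hc : IsCoprime (q : ℤ) P) (j : ℤ) :
    (Finset.range q).image (fun i : ℕ => (j + i * P) % q) = Finset.Ico (0 : ℤ) q := by
  apply Finset.eq_of_subset_of_card_le
  · intro m hm
    obtain ⟨i, _, rfl⟩ := Finset.mem_image.1 hm
    exact Finset.mem_Ico.2 ⟨Int.emod_nonneg _ (by omega), Int.emod_lt_of_pos _ (by omega)⟩
  · rw [Finset.card_image_of_injOn (injOn_emod hc j)]
    simp

theorem sum_range_cast (q : ℕ) : ∑ i ∈ Finset.range q, (i : ℝ) = q * (q - 1) / 2 := by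
  induction q with
  | zero => simp
  | succ q ih =>
    rw [Finset.sum_range_succ, ih]
    push_cast
    ring

theorem sum_emod {q : ℕ} {P : ℤ} (hq : 0 < q) (hc : IsCoprime (q : ℤ) P) (j : ℤ) :
    ∑ i ∈ Finset.range q, (((j + i * P) % q : ℤ) : ℝ) = q * (q - 1) / 2 := by
  have h1 : ∑ m ∈ Finset.Ico (0 : ℤ) q, (m : ℝ)
      = ∑ i ∈ Finset.range q, (((j + i * P) % q : ℤ) : ℝ) := by
    rw [← image_emod hq hc j, Finset.sum_image (injOn_emod hc j)]
  have h2 : ∑ m ∈ Finset.Ico (0 : ℤ) q, (m : ℝ) = ∑ i ∈ Finset.range q, (i : ℝ) := by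
    have : Finset.Ico (0 : ℤ) q = (Finset.range q).image (fun i : ℕ => (i : ℤ)) := by
      ext m
      simp only [Finset.mem_Ico, Finset.mem_image, Finset.mem_range]
      constructor
      · rintro ⟨h0, h1⟩
        exact ⟨m.toNat, by omega, by omega⟩
      · rintro ⟨i, hi, rfl⟩
        omega
    rw [this, Finset.sum_image (by intro a _ b _ h; simpa using h)]
    simp
  rw [← h1, h2, sum_range_cast]

theorem exists_emod_eq {q : ℕ} {P : ℤ} (hq : 0 < q) (hc : IsCoprime (q : ℤ) P) (m : ℤ) :
    ∃ i < q, ∃ k : ℤ, i * P = m + k * q := by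
  have h : (0 : ℤ) ∈ (Finset.range q).image (fun i : ℕ => (-m + i * P) % q) := by
    rw [image_emod hq hc]
    simp [hq]
  obtain ⟨i, hi, h⟩ := Finset.mem_image.1 h
  obtain ⟨k, hk⟩ := Int.dvd_of_emod_eq_zero h
  exact ⟨i, Finset.mem_range.1 hi, k, by linarith⟩

/-- The sum of the fractional parts along an orbit segment whose length is the denominator of a good
approximation, started away from the discontinuity. -/
theorem sum_fract_eq {α : ℝ} {q : ℕ} {P : ℤ} (hq : 0 < q) (hc : IsCoprime (q : ℤ) P) (x : ℝ)
    (h : ∀ i < q, 0 ≤ Int.fract (q * x) + i * (q * α - P) ∧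
      Int.fract (q * x) + i * (q * α - P) < 1) :
    ∑ i ∈ Finset.range q, Int.fract (x + i * α)
      = (q - 1) / 2 + Int.fract (q * x) + (q * α - P) * (q - 1) / 2 := by
  have hq' : (0 : ℝ) < q := by exact_mod_cast hq
  set y := Int.fract (q * x) with hy
  set v := q * α - P with hv
  -- Write `x + i α = (⌊q x⌋ + i P + y + i v) / q`: the integer parts of the numerators run through
  -- all residues modulo `q`, and by hypothesis `y + i v` never leaves `[0, 1)`.
  have hterm : ∀ i ∈ Finset.range q, Int.fract (x + i * α)
      = (((⌊q * x⌋ + i * P) % q : ℤ) : ℝ) / q + (y + i * v) / q := by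
    intro i hi
    obtain ⟨h0, h1⟩ := h i (Finset.mem_range.1 hi)
    have m0 : 0 ≤ (⌊q * x⌋ + i * P) % q := Int.emod_nonneg _ (by omega)
    have m1 : (⌊q * x⌋ + i * P) % q < q := Int.emod_lt_of_pos _ (by omega)
    have m2 := Int.mul_ediv_add_emod (⌊q * x⌋ + i * P) q
    set m := (⌊q * x⌋ + i * P) % q with hm
    have m0' : (0 : ℝ) ≤ m := by exact_mod_cast m0
    have m1' : (m : ℝ) + 1 ≤ q := by exact_mod_cast m1
    have m2' : (q : ℝ) * (((⌊q * x⌋ + i * P) / q : ℤ) : ℝ) + m = ⌊q * x⌋ + i * P := by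
      exact_mod_cast m2
    have hx : q * x = ⌊q * x⌋ + y := (Int.floor_add_fract _).symm
    rw [← add_div, Int.fract_eq_iff]
    refine ⟨div_nonneg (by linarith) hq'.le, by rw [div_lt_one hq']; linarith,
      (⌊q * x⌋ + i * P) / q, ?_⟩
    rw [sub_eq_iff_eq_add, ← sub_eq_iff_eq_add', eq_div_iff hq'.ne']
    linear_combination hx - m2' + i * hv
  rw [Finset.sum_congr rfl hterm, Finset.sum_add_distrib, ← Finset.sum_div, ← Finset.sum_div,
    sum_emod hq hc, Finset.sum_add_distrib, ← Finset.sum_mul, sum_range_cast]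
  simp only [Finset.sum_const, Finset.card_range, nsmul_eq_mul]
  field_simp
  ring

theorem rotSum_natCast_add (α : ℝ) (φ : UnitAddCircle → ℝ) (m n : ℕ) (x : UnitAddCircle) :
    rotSum α φ (m + n) x = rotSum α φ m x + rotSum α φ n (x + ((m * α : ℝ) : UnitAddCircle)) := by
  simp only [rotSum, Finset.sum_range_add]
  congr 1
  refine Finset.sum_congr rfl fun i _ => ?_
  rw [add_assoc, ← AddCircle.coe_add]
  push_cast
  ring_nf

theorem integral_rotSum (α : ℝ) {φ : UnitAddCircle → ℝ} (hφ : Integrable φ) (n : ℕ) :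
    ∫ x, rotSum α φ n x = n * ∫ x, φ x := by
  simp only [rotSum]
  rw [integral_finsetSum _ fun i _ => hφ.comp_add_right _]
  simp [integral_add_right_eq_self φ]

theorem coe_intCast_add (k : ℤ) (x : ℝ) : ((x + k : ℝ) : UnitAddCircle) = x := by
  have h0 : ((k : ℝ) : UnitAddCircle) = 0 := (AddCircle.coe_eq_zero_iff 1).2 ⟨k, by simp⟩
  rw [AddCircle.coe_add, h0, add_zero]

/-- Along good denominators the ergodic sums of a `C^1` function converge uniformly to their
mean. -/
theorem rotSum_good_denominator {α : ℝ} (hα : Irrational α) {φ : UnitAddCircle → ℝ}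
    (hφ : ContDiff ℝ 1 fun x : ℝ => φ (x : UnitAddCircle)) {ε : ℝ} (hε : 0 < ε) :
    ∃ Q : ℕ, ∀ (q : ℕ) (P : ℤ), Q < q → IsCoprime (q : ℤ) P → |q * α - P| ≤ 1 / (2 * q) →
      ∀ x, |q * (∫ y, φ y) - rotSum α φ q x| ≤ ε := by
  obtain ⟨C, hC0, hC⟩ := rotSum_lipschitz hα hφ (η := ε / 4) (by positivity)
  obtain ⟨Q, hQ⟩ := exists_nat_ge (4 * C / ε)
  refine ⟨Q, fun q P hQq hc hv => ?_⟩
  have hq : 0 < q := by omega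
  have hq' : (0 : ℝ) < q := by exact_mod_cast hq
  have hQq' : (Q : ℝ) ≤ q := by exact_mod_cast hQq.le
  have hCq : C ≤ ε / 4 * q := by
    rw [div_le_iff₀ hε] at hQ
    nlinarith
  have hosc : ∀ x x' : ℝ, |rotSum α φ q (x' : UnitAddCircle) - rotSum α φ q (x : UnitAddCircle)|
      ≤ ε := by
    intro x x'
    -- The orbit point `x + i α` is within `1 / q` of `x'` modulo `1`, so the Lipschitz bound of
    -- order `ε q` costs only `ε / 2`.
    obtain ⟨i, hi, k, hk⟩ := exists_emod_eq hq hc (round ((x' - x) * q))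
    set m := round ((x' - x) * q) with hm
    have hm' : |(x' - x) * q - m| ≤ 1 / 2 := abs_sub_round _
    have hk' : (i : ℝ) * P = m + k * q := by exact_mod_cast hk
    have hi' : (i : ℝ) ≤ q := by exact_mod_cast hi.le
    set v := q * α - P with hvdef
    have hv' : |v| * q ≤ 1 / 2 := by
      rw [le_div_iff₀ (by positivity)] at hv
      linarith
    have h1 : |rotSum α φ q (x' : UnitAddCircle) - rotSum α φ q ((x + i * α : ℝ) : UnitAddCircle)|
        ≤ ε / 2 := by
      rw [← coe_intCast_add k x']
      refine (hC q (x' + k) (x + i * α)).trans ?_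
      have e : q * |x' + k - (x + i * α)| ≤ 1 := by
        have e0 : q * |x' + k - (x + i * α)| = |q * (x' + k - (x + i * α))| := by
          rw [abs_mul, abs_of_pos hq']
        rw [e0]
        have : q * (x' + k - (x + i * α)) = ((x' - x) * q - m) - i * v := by
          rw [hvdef]; linear_combination -hk'
        rw [this]
        refine (abs_sub _ _).trans ?_
        rw [abs_mul, Nat.abs_cast]
        have : i * |v| ≤ q * |v| := by gcongr
        linarith
      have : ε / 4 * q + C ≤ ε / 2 * q := by linarith
      calc (ε / 4 * q + C) * |x' + k - (x + i * α)|
          ≤ ε / 2 * q * |x' + k - (x + i * α)| := by gcongr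
        _ = ε / 2 * (q * |x' + k - (x + i * α)|) := by ring
        _ ≤ ε / 2 * 1 := by gcongr
        _ = ε / 2 := mul_one _
    have h2 : |rotSum α φ q ((x + i * α : ℝ) : UnitAddCircle) - rotSum α φ q (x : UnitAddCircle)|
        ≤ ε / 2 := by
      have e1 := rotSum_natCast_add α φ i q (x : UnitAddCircle)
      have e2 := rotSum_natCast_add α φ q i (x : UnitAddCircle)
      rw [add_comm i q] at e1
      have e3 : (x : UnitAddCircle) + ((q * α : ℝ) : UnitAddCircle) = ((x + v : ℝ) : UnitAddCircle) := by
        rw [← AddCircle.coe_add, ← coe_intCast_add P (x + v)]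
        congr 1
        rw [hvdef]; ring
      rw [← AddCircle.coe_add] at e1
      rw [e3] at e2
      -- Moving the starting point by `i` steps changes the sum of length `q` by a difference of
      -- sums of length `i` at points `v` apart.
      have e4 : rotSum α φ q ((x + i * α : ℝ) : UnitAddCircle) - rotSum α φ q (x : UnitAddCircle)
          = rotSum α φ i ((x + v : ℝ) : UnitAddCircle) - rotSum α φ i (x : UnitAddCircle) := by
        linarith
      rw [e4]
      refine (hC i (x + v) x).trans ?_
      rw [add_sub_cancel_left]
      calc (ε / 4 * i + C) * |v| ≤ (ε / 4 * q + ε / 4 * q) * |v| := by gcongr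
        _ = ε / 2 * (|v| * q) := by ring
        _ ≤ ε / 2 * 1 := by gcongr; linarith
        _ = ε / 2 := mul_one _
    have := abs_sub_le (rotSum α φ q (x' : UnitAddCircle))
      (rotSum α φ q ((x + i * α : ℝ) : UnitAddCircle)) (rotSum α φ q (x : UnitAddCircle))
    linarith
  intro x
  have hφc := continuous_of_coe hφ.continuous
  have hi := integrable_of_continuous_circle hφc
  have hSi : Integrable (rotSum α φ q) :=
    integrable_finsetSum _ fun i _ => hi.comp_add_right _
  rw [← integral_rotSum α hi]
  have e : (∫ y, rotSum α φ q y) - rotSum α φ q x = ∫ y, (rotSum α φ q y - rotSum α φ q x) := by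
    rw [integral_sub hSi (integrable_const _)]
    simp [Measure.real]
  rw [e, ← Real.norm_eq_abs]
  refine (norm_integral_le_of_norm_le_const (C := ε) (ae_of_all _ fun y => ?_)).trans ?_
  · have := hosc (circleFract x) (circleFract y)
    rwa [coe_circleFract, coe_circleFract] at this
  · simp [Measure.real]

/-! ### Rigidity times with affine vertical displacement. -/

namespace IsRoof

variable {A p : ℝ} {f : UnitAddCircle → ℝ}

theorem slope_add_integral (h : IsRoof A p f) {φ : UnitAddCircle → ℝ} (hφ : Continuous φ)
    (hf : ∀ x : UnitAddCircle, f x = A * circleFract (x - (p : UnitAddCircle)) + φ x) :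
    A / 2 + ∫ x, φ x = 1 := by
  have hI := h.integral_eq_one
  simp_rw [hf] at hI
  rw [integral_add
    ((integrable_circleFract.comp_sub_right _).const_mul A) (integrable_of_continuous_circle hφ),
    integral_const_mul, integral_sub_right_eq_self circleFract, integral_circleFract] at hI
  linarith

/-- On half of each of `q` short arcs, the ergodic sum of length `q`, a good denominator, is affine
up to a small error. -/
theorem rotSum_affine (h : IsRoof A p f) {α : ℝ} (hα : Irrational α) {ε : ℝ} (hε : 0 < ε) :
    ∃ Q : ℕ, ∀ (q : ℕ) (P : ℤ), Q < q → IsCoprime (q : ℤ) P → |q * α - P| ≤ 1 / (2 * q) →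
      ∃ (e : UnitAddCircle) (t : ℝ), q - 2 * |A| ≤ t ∧ ∀ x, circleFract (q • x - e) < 1 / 2 →
        |t - rotSum α f q x + A * (circleFract (q • x - e) - 1 / 4)| ≤ ε := by
  obtain ⟨φ, hφ, hf⟩ := h.exists_eq
  obtain ⟨Q, hQ⟩ := rotSum_good_denominator hα hφ hε
  refine ⟨Q, fun q P hQq hc hv => ?_⟩
  have hq : 0 < q := by omega
  have hq' : (0 : ℝ) < q := by exact_mod_cast hq
  have hq1 : (1 : ℝ) ≤ q := by exact_mod_cast hq
  set v := q * α - P with hvdef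
  have hv' : |v| * q ≤ 1 / 2 := by
    rw [le_div_iff₀ (by positivity)] at hv
    linarith
  have hint := h.slope_add_integral (continuous_of_coe hφ.continuous) hf
  -- The drift `i v` has absolute value below `1 / 2` for `i < q`, so starting in the lower half
  -- when `v ≥ 0` and in the upper half when `v < 0` avoids the discontinuity.
  set y₀ : ℝ := if 0 ≤ v then 0 else 1 / 2 with hy₀
  refine ⟨q • (p : UnitAddCircle) + (y₀ : UnitAddCircle),
    -- This time centres the displacement: `1 / 4` is the midpoint of the parameter interval `[0,
    -- 1/2)`.
    q * (∫ x, φ x) + A * ((q - 1) / 2 + y₀ + v * (q - 1) / 2 + 1 / 4), ?_, fun x hx => ?_⟩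
  · have e : q * (∫ x, φ x) + A * ((q - 1) / 2 + y₀ + v * (q - 1) / 2 + 1 / 4)
        = q + A * (y₀ + v * (q - 1) / 2 - 1 / 4) := by
      have : ∫ x, φ x = 1 - A / 2 := by linarith
      rw [this]; ring
    have h1 : |y₀ + v * (q - 1) / 2 - 1 / 4| ≤ 2 := by
      have h0 : |v| * (q - 1) ≤ 1 / 2 := by nlinarith [abs_nonneg v]
      have h2 : |v * (q - 1)| ≤ 1 / 2 := by
        rwa [abs_mul, abs_of_nonneg (by linarith : (0 : ℝ) ≤ q - 1)]
      have h3 := abs_le.1 h2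
      have h4 : 0 ≤ y₀ ∧ y₀ ≤ 1 / 2 := by rw [hy₀]; split_ifs <;> norm_num
      rw [abs_le]
      constructor <;> linarith [h4.1, h4.2]
    have h2 : |A * (y₀ + v * (q - 1) / 2 - 1 / 4)| ≤ |A| * 2 := by
      rw [abs_mul]; gcongr
    rw [e]
    linarith [(abs_le.1 h2).1]
  · set X := circleFract (x - (p : UnitAddCircle)) with hX
    set y := circleFract (q • x - (q • (p : UnitAddCircle) + (y₀ : UnitAddCircle))) with hy
    have hyX : y = Int.fract (q * X - y₀) := by
      have : q • x - (q • (p : UnitAddCircle) + (y₀ : UnitAddCircle))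
          = ((q * X - y₀ : ℝ) : UnitAddCircle) := by
        rw [AddCircle.coe_sub, ← nsmul_eq_mul, AddCircle.coe_nsmul, hX, coe_circleFract, nsmul_sub]
        abel
      rw [hy, this, circleFract_coe]
    have hy0 : 0 ≤ y := circleFract_nonneg _
    have hfr : Int.fract (q * X) = y + y₀ := by
      rw [Int.fract_eq_iff]
      refine ⟨?_, ?_, ⌊q * X - y₀⌋, ?_⟩
      · have : 0 ≤ y₀ := by rw [hy₀]; split_ifs <;> norm_num
        linarith
      · have : y₀ ≤ 1 / 2 := by rw [hy₀]; split_ifs <;> norm_num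
        linarith
      · rw [hyX, Int.fract]; ring
    have hsum := sum_fract_eq (α := α) hq hc X fun i hi => by
      rw [hfr]
      have hi' : (i : ℝ) + 1 ≤ q := by exact_mod_cast hi
      have h1 : i * |v| < 1 / 2 := by
        rcases (abs_nonneg v).eq_or_lt with h0 | h0
        · rw [← h0]; norm_num
        · nlinarith
      rcases le_or_gt 0 v with h0 | h0
      · rw [abs_of_nonneg h0] at h1
        have h2 : 0 ≤ i * v := by positivity
        rw [hy₀, if_pos h0]
        constructor <;> linarith
      · rw [abs_of_neg h0] at h1
        have h2 : 0 ≤ i * -v := mul_nonneg i.cast_nonneg (by linarith)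
        rw [hy₀, if_neg (not_le.2 h0)]
        constructor <;> linarith
    have hrot : rotSum α f q x = A * ∑ i ∈ Finset.range q, Int.fract (X + i * α)
        + rotSum α φ q x := by
      rw [rotSum, rotSum, Finset.mul_sum, ← Finset.sum_add_distrib]
      refine Finset.sum_congr rfl fun i _ => ?_
      rw [hf, ← circleFract_coe, AddCircle.coe_add, hX, coe_circleFract, add_sub_right_comm]
    rw [hrot, hsum, hfr]
    convert hQ q P hQq hc hv x using 2
    ring

/-- Taking good denominators with errors `1 / (k + 1)`, the base rotation by `q_k α` tends to the
identity. In the chart of the `q_k`-th deck transformation, the flow at time `t_k` is then nearly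
vertical on the chosen half-arcs. -/
theorem exists_rigidity_times (h : IsRoof A p f) {α : ℝ} (hα : Irrational α) :
    ∃ (q : ℕ → ℕ) (e : ℕ → UnitAddCircle) (t : ℕ → ℝ), Tendsto q atTop atTop ∧
      Tendsto t atTop atTop ∧
      Tendsto (fun k => ((q k * α : ℝ) : UnitAddCircle)) atTop (𝓝 0) ∧
      ∀ ε > 0, ∀ᶠ k in atTop, ∀ x, circleFract (q k • x - e k) < 1 / 2 →
        |t k - rotSum α f (q k) x + A * (circleFract (q k • x - e k) - 1 / 4)| ≤ ε := by
  have hpos : ∀ k : ℕ, (0 : ℝ) < 1 / (k + 1) := fun k => by positivity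
  choose Q hQ using fun k : ℕ => h.rotSum_affine hα (hpos k)
  choose q P hq hc hv using fun k : ℕ => exists_good_denominator hα (max (Q k) k)
  choose e t ht haff using fun k : ℕ =>
    hQ k (q k) (P k) ((le_max_left _ _).trans_lt (hq k)) (hc k) (hv k)
  have hqt : Tendsto q atTop atTop :=
    tendsto_atTop_mono (fun k => ((le_max_right _ _).trans_lt (hq k)).le) tendsto_id
  have hqr : Tendsto (fun k => (q k : ℝ)) atTop atTop := tendsto_natCast_atTop_atTop.comp hqt
  refine ⟨q, e, t, hqt, ?_, ?_, ?_⟩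
  · exact tendsto_atTop_mono ht (tendsto_atTop_add_const_right _ _ hqr)
  · refine squeeze_zero_norm (a := fun k => 1 / (2 * (q k : ℝ))) (fun k => ?_) ?_
    · have := norm_coe_mul_le α (q k) (P k)
      simp only [Int.cast_natCast] at this
      exact this.trans (hv k)
    · exact (tendsto_const_nhds (x := (1 : ℝ))).div_atTop (hqr.const_mul_atTop (by norm_num))
  · intro ε hε
    have : ∀ᶠ k : ℕ in atTop, 1 / ((k : ℝ) + 1) < ε :=
      (tendsto_one_div_add_atTop_nhds_zero_nat).eventually_lt_const hε
    filter_upwards [this] with k hk x hx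
    exact (haff k x hx).trans hk.le

end IsRoof

/-! ### Lower bound: correlations along rigidity times. -/

/-- The points whose ball of radius `δ` is contained in `O`. -/
def erosion (δ : ℝ) (O : Set (UnitAddCircle × ℝ)) : Set (UnitAddCircle × ℝ) :=
  (Metric.thickening δ Oᶜ)ᶜ

theorem measurableSet_erosion (δ : ℝ) (O : Set (UnitAddCircle × ℝ)) :
    MeasurableSet (erosion δ O) :=
  Metric.isOpen_thickening.measurableSet.compl

theorem mem_of_mem_erosion {δ : ℝ} {O : Set (UnitAddCircle × ℝ)} {z z' : UnitAddCircle × ℝ}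
    (hz : z ∈ erosion δ O) (h : dist z z' < δ) : z' ∈ O := by
  by_contra hz'
  exact hz (Metric.mem_thickening_iff.2 ⟨z', hz', h⟩)

theorem erosion_anti {δ δ' : ℝ} (h : δ ≤ δ') (O : Set (UnitAddCircle × ℝ)) :
    erosion δ' O ⊆ erosion δ O :=
  compl_subset_compl.2 (Metric.thickening_mono h _)

theorem exists_mem_erosion {O : Set (UnitAddCircle × ℝ)} (hO : IsOpen O) {z : UnitAddCircle × ℝ}
    (hz : z ∈ O) : ∃ δ > 0, z ∈ erosion δ O := by
  obtain ⟨δ, hδ, hb⟩ := Metric.isOpen_iff.1 hO z hz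
  refine ⟨δ, hδ, fun h => ?_⟩
  obtain ⟨z', hz', hd⟩ := Metric.mem_thickening_iff.1 h
  exact hz' (hb (by rwa [Metric.mem_ball, dist_comm]))

/-- The set of `(z, θ)`, `θ ∈ [0, 1/2)`, such that `z` lies in `U` and the point above it at
displacement `-A (θ - 1/4)` in `U'`. -/
def limitSet (A : ℝ) (U U' : Set (UnitAddCircle × ℝ)) :
    Set ((UnitAddCircle × ℝ) × UnitAddCircle) :=
  {w | circleFract w.2 < 1 / 2 ∧ w.1 ∈ U ∧ (w.1.1, w.1.2 - A * (circleFract w.2 - 1 / 4)) ∈ U'}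

theorem limitSet_mono (A : ℝ) {U U' V V' : Set (UnitAddCircle × ℝ)} (h : U ⊆ V) (h' : U' ⊆ V') :
    limitSet A U U' ⊆ limitSet A V V' :=
  fun _ hw => ⟨hw.1, h hw.2.1, h' hw.2.2⟩

theorem measurableSet_limitSet (A : ℝ) {U U' : Set (UnitAddCircle × ℝ)} (h : MeasurableSet U)
    (h' : MeasurableSet U') : MeasurableSet (limitSet A U U') := by
  have m : Measurable fun w : (UnitAddCircle × ℝ) × UnitAddCircle => circleFract w.2 :=
    measurable_circleFract.comp measurable_snd
  refine (measurableSet_lt m measurable_const).inter ((measurable_fst h).inter ?_)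
  exact ((measurable_fst.comp measurable_fst).prodMk
    ((measurable_snd.comp measurable_fst).sub ((m.sub_const _).const_mul A))) h'

/-- The set of points `z` in `U` over `q` short arcs, whose translates by the time `t` map, in the
chart given by the `q`-th deck transformation, lie in `U'`. -/
def rigidSet (α : ℝ) (f : UnitAddCircle → ℝ) (q : ℕ) (e : UnitAddCircle) (t : ℝ)
    (U U' : Set (UnitAddCircle × ℝ)) : Set (UnitAddCircle × ℝ) :=
  {z | circleFract (q • z.1 - e) < 1 / 2 ∧ z ∈ U ∧
    (z.1 + ((q * α : ℝ) : UnitAddCircle), z.2 + (t - rotSum α f q z.1)) ∈ U'}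

theorem measurePreserving_fiber_add {Y : Type*} [MeasurableSpace Y] {μ : Measure Y} [SFinite μ]
    {c : Y → UnitAddCircle} (hc : Measurable c) :
    MeasurePreserving (fun w : Y × UnitAddCircle => (w.1, w.2 + c w.1))
      (μ.prod volume) (μ.prod volume) :=
  (MeasurePreserving.id μ).skew_product (g := fun y θ => θ + c y)
    (measurable_snd.add (hc.comp measurable_fst))
    (ae_of_all _ fun y => (measurePreserving_add_right volume (c y)).map_eq)

theorem measurable_nsmul_fst_sub (q : ℕ) (e : UnitAddCircle) :
    Measurable fun z : UnitAddCircle × ℝ => q • z.1 - e :=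
  ((continuous_nsmul q).measurable.comp measurable_fst).sub_const e

namespace IsRoof

variable {A p : ℝ} {f : UnitAddCircle → ℝ}

theorem measurableSet_rigidSet (h : IsRoof A p f) (α : ℝ) (q : ℕ) (e : UnitAddCircle) (t : ℝ)
    {U U' : Set (UnitAddCircle × ℝ)} (hU : MeasurableSet U) (hU' : MeasurableSet U') :
    MeasurableSet (rigidSet α f q e t U U') := by
  have m1 : Measurable fun z : UnitAddCircle × ℝ => circleFract (q • z.1 - e) :=
    measurable_circleFract.comp (measurable_nsmul_fst_sub q e)
  refine (measurableSet_lt m1 measurable_const).inter (hU.inter ?_)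
  exact ((measurable_fst.add_const _).prodMk (measurable_snd.add
    (((measurable_rotSum h.measurable α q).comp measurable_fst).const_sub t))) hU'

theorem measurePreserving_rigid (h : IsRoof A p f) (α : ℝ) (q : ℕ) (t : ℝ) :
    MeasurePreserving (fun z : UnitAddCircle × ℝ =>
      (z.1 + ((q * α : ℝ) : UnitAddCircle), z.2 + (t - rotSum α f q z.1))) :=
  measurePreserving_shear ((measurable_rotSum h.measurable α q).const_sub t) _

/-- Averaging over the horizontal translations by at most `1 / q`. -/
theorem volume_limitSet_erosion_le (h : IsRoof A p f) {α : ℝ} {q : ℕ} {e : UnitAddCircle} {t δ : ℝ}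
    (hq : 0 < q) (hqδ : 1 / (q : ℝ) + ‖((q * α : ℝ) : UnitAddCircle)‖ < δ)
    (haff : ∀ x, circleFract (q • x - e) < 1 / 2 →
      |t - rotSum α f q x + A * (circleFract (q • x - e) - 1 / 4)| < δ)
    {U U' : Set (UnitAddCircle × ℝ)} (hU : MeasurableSet U) (hU' : MeasurableSet U') :
    volume (limitSet A (erosion δ U) (erosion δ U')) ≤ volume (rigidSet α f q e t U U') := by
  have hq' : (0 : ℝ) < q := by exact_mod_cast hq
  have hS := h.measurableSet_rigidSet α q e t hU hU'
  have hR := measurableSet_limitSet A (measurableSet_erosion δ U) (measurableSet_erosion δ U')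
  set S := rigidSet α f q e t U U' with hSdef
  set R := limitSet A (erosion δ U) (erosion δ U') with hRdef
  -- Replacing the independent parameter `θ` by `θ + q x - e` preserves measure. A horizontal shift
  -- by `y / q` adds exactly `y` to `q x - e`, so equidistribution is an exact average, and erosion
  -- absorbs the shift.
  have hΦ : MeasurePreserving
      (fun w : (UnitAddCircle × ℝ) × UnitAddCircle => (w.1, w.2 + (q • w.1.1 - e))) :=
    measurePreserving_fiber_add (measurable_nsmul_fst_sub q e)
  have hy : ∀ y ∈ Ioc (0 : ℝ) (0 + 1),
      volume {z : UnitAddCircle × ℝ | (z, (y : UnitAddCircle) + (q • z.1 - e)) ∈ R} ≤ volume S := by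
    intro y hy
    have hshift : MeasurePreserving
        (fun z : UnitAddCircle × ℝ => (z.1 + ((y / q : ℝ) : UnitAddCircle), z.2 + 0)) :=
      measurePreserving_shear (f := fun _ => 0) measurable_const _
    rw [← hshift.measure_preimage hS.nullMeasurableSet]
    refine measure_mono fun z hz => ?_
    have hmul : q • (z.1 + ((y / q : ℝ) : UnitAddCircle)) - e
        = (y : UnitAddCircle) + (q • z.1 - e) := by
      rw [nsmul_add, ← AddCircle.coe_nsmul, nsmul_eq_mul, mul_div_cancel₀ _ hq'.ne']
      abel
    have hyq : ‖((y / q : ℝ) : UnitAddCircle)‖ ≤ 1 / q := by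
      refine (norm_coe_le_abs _).trans ?_
      rw [abs_of_pos (div_pos hy.1 hq')]
      gcongr
      linarith [hy.2]
    obtain ⟨h1, h2, h3⟩ := hz
    simp only at h1 h2 h3
    have hδ : 0 < δ := by
      have : 0 < 1 / (q : ℝ) := by positivity
      have := norm_nonneg ((q * α : ℝ) : UnitAddCircle)
      linarith
    refine ⟨?_, ?_, ?_⟩
    · simp only [hmul]
      exact h1
    · refine mem_of_mem_erosion h2 ?_
      rw [Prod.dist_eq, max_lt_iff]
      simp only [add_zero, dist_self, dist_self_add_right]
      have := norm_nonneg ((q * α : ℝ) : UnitAddCircle)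
      exact ⟨by linarith, hδ⟩
    · refine mem_of_mem_erosion h3 ?_
      rw [Prod.dist_eq, max_lt_iff]
      constructor
      · simp only
        rw [add_assoc, dist_self_add_right]
        exact (norm_add_le _ _).trans_lt (by linarith)
      · change |z.2 - A * (circleFract ((y : UnitAddCircle) + (q • z.1 - e)) - 1 / 4)
          - (z.2 + 0 + (t - rotSum α f q (z.1 + ((y / q : ℝ) : UnitAddCircle))))| < δ
        have := haff (z.1 + ((y / q : ℝ) : UnitAddCircle)) (by rw [hmul]; exact h1)
        rw [hmul] at this
        rw [← abs_neg]
        convert this using 2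
        ring
  calc volume R = volume ((fun w : (UnitAddCircle × ℝ) × UnitAddCircle =>
          (w.1, w.2 + (q • w.1.1 - e))) ⁻¹' R) := (hΦ.measure_preimage hR.nullMeasurableSet).symm
    _ = ∫⁻ θ : UnitAddCircle,
          volume {z : UnitAddCircle × ℝ | (z, θ + (q • z.1 - e)) ∈ R} := by
        rw [Measure.volume_eq_prod (UnitAddCircle × ℝ) UnitAddCircle,
          Measure.prod_apply_symm (hΦ.measurable hR)]
        rfl
    _ = ∫⁻ y in Ioc (0 : ℝ) (0 + 1),
          volume {z : UnitAddCircle × ℝ | (z, (y : UnitAddCircle) + (q • z.1 - e)) ∈ R} :=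
        (UnitAddCircle.lintegral_preimage 0 _).symm
    _ ≤ ∫⁻ _ in Ioc (0 : ℝ) (0 + 1), volume S := setLIntegral_mono' measurableSet_Ioc hy
    _ = volume S := by simp

theorem measurable_correlation (h : IsRoof A p f) (α : ℝ) {B C : Set (Space f)}
    (hB : MeasurableSet B) (hC : MeasurableSet C) :
    Measurable fun y : ℝ => volume {z : UnitAddCircle × ℝ |
      z ∈ Subtype.val '' B ∧ (z.1, z.2 + y) ∈ lift (rotation α) f C} := by
  have hm : MeasurableSet {w : ℝ × (UnitAddCircle × ℝ) |
      w.2 ∈ Subtype.val '' B ∧ (w.2.1, w.2.2 + w.1) ∈ lift (rotation α) f C} := by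
    refine (measurable_snd (h.measurableSet_image hB)).inter ?_
    exact ((measurable_fst.comp measurable_snd).prodMk
      ((measurable_snd.comp measurable_snd).add measurable_fst)) (h.measurableSet_lift α hC)
  exact measurable_measure_prodMk_left hm

/-- Substitute `y = -A (θ - 1/4)`: the interval `(0, 1/2)` goes onto `(-|A|/4, |A|/4)` with density
`1 / |A|`. -/
theorem volume_limitSet_eq (h : IsRoof A p f) {α : ℝ} (hα : Irrational α) {B C : Set (Space f)}
    (hB : MeasurableSet B) (hC : MeasurableSet C) :
    volume (limitSet A (Subtype.val '' B) (lift (rotation α) f C))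
      = ENNReal.ofReal |A⁻¹| * ∫⁻ y in Ioo (-(|A| / 4)) (|A| / 4),
          spaceMeasure volume f (B ∩ flow (rotation α) f y ⁻¹' C) := by
  simp_rw [fun y => h.spaceMeasure_inter_flow hα y hB hC]
  set N : ℝ → ENNReal := fun y => volume {z : UnitAddCircle × ℝ |
      z ∈ Subtype.val '' B ∧ (z.1, z.2 + y) ∈ lift (rotation α) f C} with hN
  have hNm : Measurable N := h.measurable_correlation α hB hC
  have hA := h.slope_ne_zero
  set b := |A| / 4 with hb
  have hL := measurableSet_limitSet A (h.measurableSet_image hB) (h.measurableSet_lift α hC)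
  have hslice : ∀ y : ℝ, y ≠ 0 → y ≠ 1 → (Ioc (0 : ℝ) (0 + 1)).indicator (fun y => volume
      ((fun z : UnitAddCircle × ℝ => (z, (y : UnitAddCircle))) ⁻¹'
        limitSet A (Subtype.val '' B) (lift (rotation α) f C))) y
      = (Ioo (-b) b).indicator N (-A * y + A / 4) := by
    intro y hy0 hy1
    have hiff : -A * y + A / 4 ∈ Ioo (-b) b ↔ y ∈ Ioo (0 : ℝ) (1 / 2) := by
      have e : -A * y + A / 4 = -A * (y - 1 / 4) := by ring
      have hA0 := abs_pos.2 hA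
      rw [mem_Ioo, ← abs_lt, e, abs_mul, abs_neg, hb, show |A| / 4 = |A| * (1 / 4) by ring,
        mul_lt_mul_iff_right₀ hA0,
        abs_lt, mem_Ioo]
      constructor <;> rintro ⟨h1, h2⟩ <;> constructor <;> linarith
    by_cases hy : y ∈ Ioc (0 : ℝ) (0 + 1)
    · have hy2 : y < 1 := lt_of_le_of_ne (by linarith [hy.2]) hy1
      have hcf : circleFract (y : UnitAddCircle) = y := by
        rw [circleFract_coe, Int.fract_eq_self.2 ⟨hy.1.le, hy2⟩]
      rw [indicator_of_mem hy]
      by_cases hy3 : y ∈ Ioo (0 : ℝ) (1 / 2)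
      · rw [indicator_of_mem (hiff.2 hy3)]
        congr 1
        ext z
        simp only [limitSet, mem_preimage, mem_ofPred_eq, hcf]
        rw [show z.2 - A * (y - 1 / 4) = z.2 + (-A * y + A / 4) by ring]
        exact and_iff_right hy3.2
      · rw [indicator_of_notMem (fun h => hy3 (hiff.1 h))]
        convert measure_empty (μ := (volume : Measure (UnitAddCircle × ℝ)))
        rw [eq_empty_iff_forall_notMem]
        intro z hz
        have := hz.1
        simp only [hcf] at this
        exact hy3 ⟨hy.1, this⟩
    · rw [indicator_of_notMem hy, indicator_of_notMem]
      intro h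
      have := hiff.1 h
      exact hy ⟨this.1, by linarith [this.2]⟩
  rw [Measure.volume_eq_prod (UnitAddCircle × ℝ) UnitAddCircle, Measure.prod_apply_symm hL,
    ← UnitAddCircle.lintegral_preimage 0, ← lintegral_indicator measurableSet_Ioc]
  have hF : Measurable ((Ioo (-b) b).indicator N) := hNm.indicator measurableSet_Ioo
  calc ∫⁻ y, (Ioc (0 : ℝ) (0 + 1)).indicator (fun y : ℝ => volume
      ((fun z : UnitAddCircle × ℝ => (z, (y : UnitAddCircle))) ⁻¹'
        limitSet A (Subtype.val '' B) (lift (rotation α) f C))) y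
      = ∫⁻ y, (Ioo (-b) b).indicator N (-A * y + A / 4) := by
        have h0 : ∀ᵐ y : ℝ, y ≠ 0 := by simp [ae_iff]
        have h1 : ∀ᵐ y : ℝ, y ≠ 1 := by simp [ae_iff]
        refine lintegral_congr_ae ?_
        filter_upwards [h0, h1] with y hy0 hy1
        exact hslice y hy0 hy1
    _ = ∫⁻ y, (Ioo (-b) b).indicator N (y + A / 4) ∂(Measure.map (-A * ·) volume) :=
        (lintegral_map (hF.comp (measurable_id.add_const _)) (measurable_const_mul _)).symm
    _ = ENNReal.ofReal |A⁻¹| * ∫⁻ y in Ioo (-b) b, N y := by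
        rw [Real.map_volume_mul_left (neg_ne_zero.2 hA), lintegral_smul_measure, inv_neg, abs_neg,
          lintegral_add_right_eq_self, lintegral_indicator measurableSet_Ioo, smul_eq_mul]

end IsRoof

/-- Continuity from below of the measure of `limitSet` under erosion of open sets. -/
theorem exists_lt_volume_limitSet_erosion {A : ℝ} {U U' : Set (UnitAddCircle × ℝ)} (hU : IsOpen U)
    (hU' : IsOpen U') {r : ENNReal} (hr : r < volume (limitSet A U U')) :
    ∃ δ > 0, r < volume (limitSet A (erosion δ U) (erosion δ U')) := by
  have hmono : Monotone fun n : ℕ =>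
      limitSet A (erosion (1 / ((n : ℝ) + 1)) U) (erosion (1 / ((n : ℝ) + 1)) U') := by
    intro m n hmn
    have := Nat.one_div_le_one_div (α := ℝ) hmn
    exact limitSet_mono A (erosion_anti this U) (erosion_anti this U')
  have hunion : limitSet A U U' ⊆ ⋃ n : ℕ,
      limitSet A (erosion (1 / ((n : ℝ) + 1)) U) (erosion (1 / ((n : ℝ) + 1)) U') := by
    rintro w ⟨h1, h2, h3⟩
    obtain ⟨δ, hδ, h2⟩ := exists_mem_erosion hU h2
    obtain ⟨δ', hδ', h3⟩ := exists_mem_erosion hU' h3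
    obtain ⟨n, hn⟩ := exists_nat_one_div_lt (lt_min hδ hδ')
    exact mem_iUnion.2 ⟨n, h1, erosion_anti (hn.le.trans (min_le_left _ _)) U h2,
      erosion_anti (hn.le.trans (min_le_right _ _)) U' h3⟩
  have hlt := hr.trans_le (measure_mono hunion)
  rw [hmono.measure_iUnion, lt_iSup_iff] at hlt
  obtain ⟨n, hn⟩ := hlt
  exact ⟨_, Nat.one_div_pos_of_nat, hn⟩

namespace IsRoof

variable {A p : ℝ} {f : UnitAddCircle → ℝ}

/-- Lifts are invariant under deck transformations, so landing in the lift in the `q`-th chart is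
landing in it at all; only this one chart is needed for a lower bound. -/
theorem rigidSet_subset (α : ℝ) (q : ℕ) (e : UnitAddCircle) (t : ℝ) {B C : Set (Space f)} :
    rigidSet α f q e t (Subtype.val '' B) (lift (rotation α) f C)
      ⊆ {z | z ∈ Subtype.val '' B ∧ (z.1, z.2 + t) ∈ lift (rotation α) f C} := by
  rintro z ⟨-, h2, h3⟩
  refine ⟨h2, (deck_mem_lift_iff _ f C q _).1 ?_⟩
  convert h3 using 1
  simp only [deck, rotation_zpow, cocycle_natCast, Int.cast_natCast, add_sub_assoc]

/-- Along the rigidity times the correlations are asymptotically at least an average of the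
correlations at times of absolute value at most `|A| / 4`. -/
theorem exists_times_le_correlation (h : IsRoof A p f) {α : ℝ} (hα : Irrational α) :
    ∃ t : ℕ → ℝ, Tendsto t atTop atTop ∧ ∀ B C : Set (Space f), MeasurableSet B →
      MeasurableSet C → ∀ r < ENNReal.ofReal |A⁻¹| * ∫⁻ y in Ioo (-(|A| / 4)) (|A| / 4),
          spaceMeasure volume f (B ∩ flow (rotation α) f y ⁻¹' C),
        ∀ ε : ENNReal, ε ≠ 0 → ∀ᶠ k in atTop,
          r ≤ spaceMeasure volume f (B ∩ flow (rotation α) f (t k) ⁻¹' C) + ε := by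
  obtain ⟨q, e, t, hq, ht, hqα, haff⟩ := h.exists_rigidity_times hα
  refine ⟨t, ht, fun B C hB hC r hr ε hε => ?_⟩
  rw [← h.volume_limitSet_eq hα hB hC] at hr
  obtain ⟨M, hM⟩ := h.exists_bound
  have hB' := h.measurableSet_image hB
  have hC' := h.measurableSet_lift α hC
  have hBfin : volume (Subtype.val '' B) ≠ ⊤ := by
    rw [← h.spaceMeasure_apply hB]
    exact ((measure_mono (subset_univ B)).trans_lt h.spaceMeasure_univ_lt_top).ne
  -- Heights over `B` are at most `|M|` and displacements at most `|A|`. Truncating the lift there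
  -- makes its measure finite, so that an open superset with small excess exists.
  set K := |M| + |A| with hK
  set C₁ := lift (rotation α) f C ∩ univ ×ˢ Icc (-K) K with hC₁
  have hC₁m : MeasurableSet C₁ := hC'.inter (MeasurableSet.univ.prod measurableSet_Icc)
  have hC₁fin : volume C₁ ≠ ⊤ := by
    refine ((measure_mono inter_subset_right).trans_lt ?_).ne
    rw [Measure.volume_eq_prod, Measure.prod_prod, Real.volume_Icc]
    exact ENNReal.mul_lt_top (measure_lt_top _ _) ENNReal.ofReal_lt_top
  have hsub : limitSet A (Subtype.val '' B) (lift (rotation α) f C)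
      ⊆ limitSet A (Subtype.val '' B) C₁ := by
    rintro w ⟨h1, h2, h3⟩
    refine ⟨h1, h2, h3, mem_univ _, ?_⟩
    obtain ⟨z, -, hz⟩ := h2
    have hz1 : 0 ≤ w.1.2 := hz ▸ z.2.1
    have hz2 : w.1.2 ≤ |M| := (hz ▸ z.2.2.le.trans (hM _)).trans (le_abs_self M)
    have hc : |A * (circleFract w.2 - 1 / 4)| ≤ |A| := by
      rw [abs_mul]
      refine mul_le_of_le_one_right (abs_nonneg A) (abs_le.2 ⟨?_, ?_⟩)
      · linarith [circleFract_nonneg w.2]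
      · linarith [circleFract_lt_one w.2]
    obtain ⟨hc1, hc2⟩ := abs_le.1 hc
    have := abs_nonneg M
    constructor <;> simp only <;> linarith
  have hε2 : ε / 2 ≠ 0 := ENNReal.half_pos hε |>.ne'
  obtain ⟨U, hBU, hU, -, hUd⟩ := hB'.exists_isOpen_sdiff_lt hBfin hε2
  obtain ⟨U', hCU', hU', -, hUd'⟩ := hC₁m.exists_isOpen_sdiff_lt hC₁fin hε2
  obtain ⟨δ, hδ, hrδ⟩ := exists_lt_volume_limitSet_erosion hU hU'
    (hr.trans_le (measure_mono (hsub.trans (limitSet_mono A hBU hCU'))))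
  have hqinv : Tendsto (fun k => 1 / (q k : ℝ)) atTop (𝓝 0) :=
    tendsto_one_div_atTop_nhds_zero_nat.comp hq
  have hsum := hqinv.add hqα.norm
  rw [norm_zero, add_zero] at hsum
  filter_upwards [haff (δ / 2) (half_pos hδ), hsum.eventually_lt_const hδ, hq.eventually_gt_atTop 0]
    with k hk1 hk2 hk3
  have key := h.volume_limitSet_erosion_le hk3 hk2
    (fun x hx => (hk1 x hx).trans_lt (half_lt_self hδ)) hU.measurableSet hU'.measurableSet
  set Φ : UnitAddCircle × ℝ → UnitAddCircle × ℝ := fun z =>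
    (z.1 + ((q k * α : ℝ) : UnitAddCircle), z.2 + (t k - rotSum α f (q k) z.1)) with hΦ
  -- Passing from `U`, `U'` back to the original sets loses one excess directly and the other
  -- through the measure-preserving `Φ`, at most `ε / 2` each.
  have hcover : rigidSet α f (q k) (e k) (t k) U U' ⊆
      ({z | z ∈ Subtype.val '' B ∧ (z.1, z.2 + t k) ∈ lift (rotation α) f C}
        ∪ (U \ Subtype.val '' B)) ∪ Φ ⁻¹' (U' \ C₁) := by
    rintro z ⟨h1, h2, h3⟩
    by_cases hz : Φ z ∈ C₁
    · by_cases hz' : z ∈ Subtype.val '' B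
      · exact Or.inl (Or.inl (rigidSet_subset α (q k) (e k) (t k) ⟨h1, hz', hz.1⟩))
      · exact Or.inl (Or.inr ⟨h2, hz'⟩)
    · exact Or.inr ⟨h3, hz⟩
  have hΦm : MeasurePreserving Φ := h.measurePreserving_rigid α (q k) (t k)
  rw [h.spaceMeasure_inter_flow hα _ hB hC]
  calc r ≤ volume (rigidSet α f (q k) (e k) (t k) U U') := hrδ.le.trans key
    _ ≤ _ := measure_mono hcover
    _ ≤ _ := measure_union_le _ _
    _ ≤ volume {z | z ∈ Subtype.val '' B ∧ (z.1, z.2 + t k) ∈ lift (rotation α) f C}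
          + ε / 2 + ε / 2 := by
        refine add_le_add ((measure_union_le _ _).trans (add_le_add le_rfl hUd.le)) ?_
        rw [hΦm.measure_preimage (hU'.measurableSet.diff hC₁m).nullMeasurableSet]
        exact hUd'.le
    _ = _ := by rw [add_assoc, ENNReal.add_halves]

end IsRoof

/-! ### Transport of correlations and comparison of slopes. -/

/-- The relation `S' ∘ S = id` is needed at the points `T_t (S' y)`, so its exceptional null set
must be pulled back by `T_t`. -/
theorem FlowIsomorphic.symm {X Y : Type*} [MeasurableSpace X] [MeasurableSpace Y] {μ : Measure X}
    {T : ℝ → X → X} {ν : Measure Y} {R : ℝ → Y → Y}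
    (hT : ∀ t, Measure.QuasiMeasurePreserving (T t) μ μ) (h : FlowIsomorphic μ T ν R) :
    FlowIsomorphic ν R μ T := by
  obtain ⟨S, S', hS, hS', hl, hr, hc⟩ := h
  refine ⟨S', S, hS', hS, hr, hl, fun t => ?_⟩
  filter_upwards [hr, hS'.quasiMeasurePreserving.ae (hc t),
    ((hT t).comp hS'.quasiMeasurePreserving).ae hl] with y h1 h2 h3
  rw [h1] at h2
  rw [← h2]
  exact h3

theorem FlowIsomorphic.exists_measure_inter_eq {X Y : Type*} [MeasurableSpace X]
    [MeasurableSpace Y] {μ : Measure X} {T : ℝ → X → X} {ν : Measure Y} {R : ℝ → Y → Y}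
    (hR : ∀ t, Measurable (R t)) (h : FlowIsomorphic μ T ν R) {E : Set Y} (hE : MeasurableSet E) :
    ∃ B : Set X, MeasurableSet B ∧ ∀ t, μ (B ∩ T t ⁻¹' B) = ν (E ∩ R t ⁻¹' E) := by
  obtain ⟨S, S', hS, hS', hl, hr, hc⟩ := h
  refine ⟨S ⁻¹' E, hS.measurable hE, fun t => ?_⟩
  rw [← hS.measure_preimage (hE.inter (hR t hE)).nullMeasurableSet]
  refine measure_congr ?_
  filter_upwards [hc t] with x hx
  refine propext (and_congr_right fun _ => ?_)
  change S (T t x) ∈ E ↔ R t (S x) ∈ E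
  rw [hx]

theorem IsRoof.abs_slope_le {A A' p p' α β : ℝ} {f g : UnitAddCircle → ℝ} (hf : IsRoof A p f)
    (hg : IsRoof A' p' g) (hα : Irrational α) (hβ : Irrational β)
    (h : SpecialFlowsIsomorphic α f β g) : |A'| ≤ |A| := by
  by_contra! hlt
  have hA : 0 < |A| := abs_pos.2 hf.slope_ne_zero
  have hA' : 0 < |A'| := abs_pos.2 hg.slope_ne_zero
  -- Any `θ < |A'| / |A|` makes `θ V / |A'|` smaller than `V / |A|`. The box is then taken with
  -- window `|A| / 4`, the one in the lower bound for the other flow.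
  obtain ⟨θ, hθ, hθ'⟩ := exists_between ((one_lt_div hA).2 hlt)
  obtain ⟨E, hE, V, hV, hVle, hEt⟩ :=
    hg.exists_box_correlation_le hβ hθ (show 0 < |A| / 4 by positivity)
  obtain ⟨B, hB, hBE⟩ := h.exists_measure_inter_eq (hg.measurable_flow hβ) hE
  obtain ⟨t, ht, hcor⟩ := hf.exists_times_le_correlation hα
  have hlt' : θ * V / |A'| < |A⁻¹| * V := by
    rw [abs_inv, div_lt_iff₀ hA', mul_right_comm, ← div_eq_inv_mul]
    gcongr
  obtain ⟨r, hr1, hr2⟩ := exists_between hlt'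
  have hpos : 0 < θ * V / |A'| := by positivity
  have hr : ENNReal.ofReal r < ENNReal.ofReal |A⁻¹| * ∫⁻ y in Ioo (-(|A| / 4)) (|A| / 4),
      spaceMeasure volume f (B ∩ flow (rotation α) f y ⁻¹' B) := by
    simp_rw [hBE]
    calc ENNReal.ofReal r < ENNReal.ofReal (|A⁻¹| * V) :=
          (ENNReal.ofReal_lt_ofReal_iff (by linarith)).2 hr2
      _ = ENNReal.ofReal |A⁻¹| * ENNReal.ofReal V := ENNReal.ofReal_mul (abs_nonneg _)
      _ ≤ _ := by gcongr
  have hε : 0 < (r - θ * V / |A'|) / 2 := by linarith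
  obtain ⟨k, hk1, hk2⟩ := ((hcor B B hB hB _ hr _ (ENNReal.ofReal_pos.2 hε).ne').and
    (ht.eventually hEt)).exists
  rw [hBE] at hk1
  have := hk1.trans (add_le_add hk2 le_rfl)
  rw [← ENNReal.ofReal_add hpos.le hε.le, ENNReal.ofReal_le_ofReal_iff (by linarith)] at this
  linarith

theorem IsRoof.abs_slope_eq {A A' p p' α β : ℝ} {f g : UnitAddCircle → ℝ} (hf : IsRoof A p f)
    (hg : IsRoof A' p' g) (hα : Irrational α) (hβ : Irrational β)
    (h : SpecialFlowsIsomorphic α f β g) : |A| = |A'| :=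
  le_antisymm (hg.abs_slope_le hf hβ hα (FlowIsomorphic.symm (hf.quasiMeasurePreserving_flow hα) h))
    (hf.abs_slope_le hg hα hβ h)

end VonNeumannFlow

end

theorem theorem1p1 :
    (∀ (α β : ℝ) (f g : UnitAddCircle → ℝ) (A_f A_g : ℝ),
      Irrational α → Irrational β →
      VonNeumannFlow.IsRoof A_f 0 f → VonNeumannFlow.IsRoof A_g 0 g →
      |A_f| ≠ |A_g| → ¬ VonNeumannFlow.SpecialFlowsIsomorphic α f β g) ∧
    (∀ (α β : ℝ) (f g : UnitAddCircle → ℝ) (A_f A_g p q : ℝ),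
      Irrational α → Irrational β →
      VonNeumannFlow.IsRoof A_f p f → VonNeumannFlow.IsRoof A_g q g →
      VonNeumannFlow.SpecialFlowsIsomorphic α f β g → |A_f| = |A_g|) :=
  ⟨fun _ _ _ _ _ _ hα hβ hf hg hne h => hne (hf.abs_slope_eq hg hα hβ h),
    fun _ _ _ _ _ _ _ _ hα hβ hf hg h => hf.abs_slope_eq hg hα hβ h⟩
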